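/- Let $T$ be an ergodic automorphism (invertible, bimeasurable, measure-preserving) of a standard Borel probability space $(X,\mathcal B,\mu)$, and let $f:X\to\mathbb R_{>0}$ be an integrable function with $\inf_{x\in X} f(x)>0$. For $n\in\mathbb Z$ let $S_n(f)(x)=\sum_{0\le i<n}f(T^ix)$ if $n\ge 0$ and $S_n(f)(x)=-\sum_{n\le i<0}f(T^ix)$ if $n<0$. Let $(T^f_t)_{t\in\mathbb R}$ be the special flow over $T$ under $f$: it acts on $X^f=\{(x,r)\in X\times\mathbb R: 0\le r<f(x)\}$, with the finite measure $\mu^f$ obtained by restricting $\mu\times\mathrm{Leb}$ to $X^f$, by $T^f_t(x,r)=(T^nx,\ r+t-S_n(f)(x))$, where $n\in\mathbb Z$ is the unique integer with $S_n(f)(x)\le r+t<S_{n+1}(f)(x)$. Suppose that there are a rigidity sequence $(h_n)_{n\in\mathbb N}$ for $T$ (a strictly increasing sequence of natural numbers with $\mu(A\triangle T^{h_n}A)\to 0$ for every $A\in\mathcal B$), Borel sets $C_n\subset X$ with $\mu(C_n)\to 1$, real numbers $c_n$, and constants $C,b>0$ such that $$\mu(\{x\in C_n: |S_{h_n}(f)(x)-c_n|\ge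 t\})\le C e^{-bt}\qquad\text{for all } t\ge 0 \text{ and } n\in\mathbb N.$$ For a measurable measure-preserving flow $(S_t)$ on $(Y,\nu)$ and $g\in L^2(Y,\nu)$ let the spectral measure $\sigma_g$ be the unique finite Borel measure on $\mathbb R$ with $\langle g\circ S_t,g\rangle=\int_{\mathbb R} e^{its}\,d\sigma_g(s)$ for all $t\in\mathbb R$. Then: 1. $(T^f_t)$ has purely singular spectrum: for every $g\in L^2(X^f,\mu^f)$ the spectral measure $\sigma_g$ is singular with respect to Lebesgue measure on $\mathbb R$. 2. $(T^f_t)$ is spectrally disjoint from every mixing flow: if $(R_t)_{t\in\mathbb R}$ is a measurable measure-preserving flow on a standard Borel probability space $(Z,\rho)$ with $\rho(A\cap R_t^{-1}B)\to\rho(A)\rho(B)$ as $t\to+\infty$ for all measurable $A,B\subset Z$, then for all $g\in L^2(X^f,\mu^f)$ and $k\in L^2(Z,\rho)$ with zero integral, the spectral measures $\sigma_g$ and $\sigma_k$ are mutually singular. -/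

import Mathlib

open MeasureTheory Filter Topology

namespace SpecialFlow

/-- The Birkhoff sum `S_n(f)(x)` over an invertible map `T`, for an integer `n`:
`∑_{0 ≤ i < n} f (T^i x)` if `n ≥ 0`, and `-∑_{n ≤ i < 0} f (T^i x)` if `n < 0`. -/
noncomputable def intBirkhoffSum {X : Type*} (T : Equiv.Perm X) (f : X → ℝ) (n : ℤ) (x : X) : ℝ :=
  if 0 ≤ n then ∑ i ∈ Finset.Ico (0 : ℤ) n, f ((T ^ i) x)
  else -∑ i ∈ Finset.Ico n (0 : ℤ), f ((T ^ i) x)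

/-- The region `X^f = {(x, r) : 0 ≤ r < f x}` under the graph of the roof function `f`. -/
def region {X : Type*} (f : X → ℝ) : Set (X × ℝ) :=
  {p | 0 ≤ p.2 ∧ p.2 < f p.1}

/-- The measure `μ^f`: the restriction of `μ × Lebesgue` to `X^f`. -/
noncomputable def regionMeasure {X : Type*} [MeasurableSpace X] (μ : Measure X) (f : X → ℝ) :
    Measure (X × ℝ) :=
  (μ.prod volume).restrict (region f)

/-- The number `n = n(t, (x, r))` of jumps: the integer with
`S_n(f)(x) ≤ r + t < S_{n+1}(f)(x)`.  It exists and is unique when `f` is bounded below by a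
positive constant, see `existsUnique_jumps`. -/
noncomputable def jumps {X : Type*} (T : Equiv.Perm X) (f : X → ℝ) (t : ℝ) (p : X × ℝ) : ℤ :=
  Classical.epsilon fun n : ℤ =>
    intBirkhoffSum T f n p.1 ≤ p.2 + t ∧ p.2 + t < intBirkhoffSum T f (n + 1) p.1

/-- The special flow `T^f_t (x, r) = (T^n x, r + t - S_n(f)(x))` with `n = n(t, (x, r))`.
Only its values on `X^f`, which has full measure for `μ^f`, matter. -/
noncomputable def flow {X : Type*} (T : Equiv.Perm X) (f : X → ℝ) (t : ℝ) (p : X × ℝ) : X × ℝ :=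
  ((T ^ jumps T f t p) p.1, p.2 + t - intBirkhoffSum T f (jumps T f t p) p.1)

theorem intBirkhoffSum_zero {X : Type*} (T : Equiv.Perm X) (f : X → ℝ) (x : X) :
    intBirkhoffSum T f 0 x = 0 := by
  simp [intBirkhoffSum]

theorem intBirkhoffSum_succ {X : Type*} (T : Equiv.Perm X) (f : X → ℝ) (n : ℤ) (x : X) :
    intBirkhoffSum T f (n + 1) x = intBirkhoffSum T f n x + f ((T ^ n) x) := by
  unfold intBirkhoffSum
  by_cases h : 0 ≤ n
  · rw [if_pos (by omega), if_pos h]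
    have : Finset.Ico 0 (n + 1) = insert n (Finset.Ico 0 n) := by
      ext i; simp only [Finset.mem_Ico, Finset.mem_insert]; omega
    rw [this, Finset.sum_insert (by simp)]
    ring
  · rw [if_neg h]
    have : Finset.Ico n 0 = insert n (Finset.Ico (n + 1) 0) := by
      ext i; simp only [Finset.mem_Ico, Finset.mem_insert]; omega
    rw [this, Finset.sum_insert (by simp)]
    by_cases h' : 0 ≤ n + 1
    · have h0 : n + 1 = 0 := by omega
      rw [h0]
      simp
    · rw [if_neg h']
      ring

theorem intBirkhoffSum_lower {X : Type*} (T : Equiv.Perm X) (f : X → ℝ) {a : ℝ}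
    (hf : ∀ x, a ≤ f x) (x : X) (m : ℤ) (k : ℕ) :
    intBirkhoffSum T f m x + k * a ≤ intBirkhoffSum T f (m + k) x := by
  induction k with
  | zero => simp
  | succ k ih =>
    have h := intBirkhoffSum_succ T f (m + k) x
    have h2 := hf ((T ^ (m + k)) x)
    have e : m + ((k + 1 : ℕ) : ℤ) = m + k + 1 := by push_cast; ring
    rw [e, h]
    push_cast
    linarith

/-- The number of jumps is well defined for a roof function bounded below by `a > 0`. -/
theorem existsUnique_jumps {X : Type*} (T : Equiv.Perm X) (f : X → ℝ) {a : ℝ} (ha : 0 < a)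
    (hf : ∀ x, a ≤ f x) (t : ℝ) (p : X × ℝ) :
    ∃! n : ℤ, intBirkhoffSum T f n p.1 ≤ p.2 + t ∧
      p.2 + t < intBirkhoffSum T f (n + 1) p.1 := by
  set S := fun n : ℤ => intBirkhoffSum T f n p.1 with hS
  have low : ∀ (m n : ℤ), m ≤ n → S m + (n - m : ℤ) * a ≤ S n := by
    intro m n hmn
    obtain ⟨k, rfl⟩ := Int.le.dest hmn
    simpa using intBirkhoffSum_lower T f hf p.1 m k
  have S0 : S 0 = 0 := intBirkhoffSum_zero T f p.1
  obtain ⟨N, hN⟩ := exists_nat_gt (|p.2 + t| / a)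
  rw [div_lt_iff₀ ha] at hN
  have hup : p.2 + t < S N := by
    have := low 0 N (by positivity)
    rw [S0] at this
    push_cast at this
    linarith [le_abs_self (p.2 + t)]
  have hdn : S (-N) ≤ p.2 + t := by
    have := low (-N) 0 (by simp)
    rw [S0] at this
    push_cast at this
    linarith [neg_abs_le (p.2 + t)]
  have mono : ∀ m n : ℤ, m ≤ n → S m ≤ S n := by
    intro m n hmn
    have h := low m n hmn
    have : (0 : ℝ) ≤ ((n - m : ℤ) : ℝ) := by exact_mod_cast sub_nonneg.2 hmn
    nlinarith
  obtain ⟨n, hn, hmax⟩ := Int.exists_greatest_of_bdd (P := fun n => S n ≤ p.2 + t)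
    ⟨N, fun z hz => by
      by_contra hlt
      push Not at hlt
      linarith [mono _ _ hlt.le]⟩ ⟨-N, hdn⟩
  refine ⟨n, ⟨hn, ?_⟩, ?_⟩
  · by_contra hlt
    push Not at hlt
    have := hmax _ hlt
    omega
  · rintro m ⟨hm1, hm2⟩
    refine le_antisymm (hmax m hm1) ?_
    by_contra hlt
    push Not at hlt
    have := mono (m + 1) n hlt
    have hn' : S n ≤ p.2 + t := hn
    have hm2' : p.2 + t < S (m + 1) := hm2
    linarith

theorem jumps_spec {X : Type*} (T : Equiv.Perm X) (f : X → ℝ) {a : ℝ} (ha : 0 < a)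
    (hf : ∀ x, a ≤ f x) (t : ℝ) (p : X × ℝ) :
    intBirkhoffSum T f (jumps T f t p) p.1 ≤ p.2 + t ∧
      p.2 + t < intBirkhoffSum T f (jumps T f t p + 1) p.1 :=
  Classical.epsilon_spec (existsUnique_jumps T f ha hf t p).exists

/-- The special flow maps into `X^f`. -/
theorem flow_mem_region {X : Type*} (T : Equiv.Perm X) (f : X → ℝ) {a : ℝ} (ha : 0 < a)
    (hf : ∀ x, a ≤ f x) (t : ℝ) (p : X × ℝ) : flow T f t p ∈ region f := by
  have h := jumps_spec T f ha hf t p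
  rw [intBirkhoffSum_succ] at h
  constructor
  · simp only [flow]; linarith [h.1]
  · simp only [flow]; linarith [h.2]

end SpecialFlow

/-- `h` is a rigidity sequence for `T`: a strictly increasing sequence of natural numbers with
`μ (A ∆ T^{h n} A) → 0` for every measurable set `A`. -/
def IsRigiditySequence {X : Type*} [MeasurableSpace X] (T : X → X) (μ : Measure X)
    (h : ℕ → ℕ) : Prop :=
  StrictMono h ∧ ∀ A : Set X, MeasurableSet A →
    Tendsto (fun n => μ (symmDiff A (T^[h n] '' A))) atTop (𝓝 0)

/-- `σ` is the spectral measure of `g ∈ L²(Y, ν)` for the flow `S`: a finite Borel measure on `ℝ`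
with `⟨g ∘ S_t, g⟩ = ∫ e^{its} dσ(s)` for every `t`.  For a measurable measure-preserving flow and
a square-integrable `g` there is exactly one such measure (Bochner). -/
def IsSpectralMeasure {Y : Type*} [MeasurableSpace Y] (S : ℝ → Y → Y) (ν : Measure Y) (g : Y → ℂ)
    (σ : Measure ℝ) : Prop :=
  IsFiniteMeasure σ ∧ ∀ t : ℝ,
    ∫ y, g (S t y) * (starRingEnd ℂ) (g y) ∂ν = ∫ s : ℝ, Complex.exp (Complex.I * t * s) ∂σ

/-- Purely singular spectrum: for every `g ∈ L²(Y, ν)` the spectral measure of `g` is singular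
with respect to Lebesgue measure. -/
def HasSingularSpectrum {Y : Type*} [MeasurableSpace Y] (S : ℝ → Y → Y) (ν : Measure Y) : Prop :=
  ∀ g : Y → ℂ, MemLp g 2 ν → ∀ σ : Measure ℝ, IsSpectralMeasure S ν g σ → σ ⟂ₘ volume

/-- Spectral disjointness of two flows: the spectral measures of zero-mean square-integrable
functions for the first flow are singular to those for the second flow, i.e. the maximal spectral
types on the orthocomplements of the constants are mutually singular. -/
def SpectrallyDisjoint {Y Z : Type*} [MeasurableSpace Y] [MeasurableSpace Z]
    (S : ℝ → Y → Y) (ν : Measure Y) (R : ℝ → Z → Z) (ρ : Measure Z) : Prop :=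
  ∀ g : Y → ℂ, MemLp g 2 ν → ∫ y, g y ∂ν = 0 →
  ∀ k : Z → ℂ, MemLp k 2 ρ → ∫ z, k z ∂ρ = 0 →
  ∀ σ τ : Measure ℝ, IsSpectralMeasure S ν g σ → IsSpectralMeasure R ρ k τ → σ ⟂ₘ τ

/-- A measurable, measure-preserving action of `ℝ`. -/
structure IsMeasurePreservingFlow {Z : Type*} [MeasurableSpace Z] (R : ℝ → Z → Z)
    (ρ : Measure Z) : Prop where
  map_zero : ∀ z, R 0 z = z
  map_add : ∀ s t z, R (s + t) z = R s (R t z)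
  measurable : Measurable fun p : ℝ × Z => R p.1 p.2
  preserving : ∀ t, MeasurePreserving (R t) ρ ρ

/-- A mixing flow on a probability space. -/
structure IsMixingFlow {Z : Type*} [MeasurableSpace Z] (R : ℝ → Z → Z)
    (ρ : Measure Z) : Prop extends IsMeasurePreservingFlow R ρ where
  mixing : ∀ A B : Set Z, MeasurableSet A → MeasurableSet B →
    Tendsto (fun t : ℝ => ρ (A ∩ R t ⁻¹' B)) atTop (𝓝 (ρ A * ρ B))

open MeasureTheory Filter Topology
open scoped ComplexConjugate ENNReal

/-! ### Weak convergence to zero in `L²` -/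

/-! Let `ξ_n` be `S_{h_n}(f) - c_n` on `C_n` and zero elsewhere, with distribution `P_n`. After
`h_n` jumps, flowing `(x, r)` for time `c_n + s` with `x ∈ C_n` amounts to flowing `(T^{h_n} x, r)`
for time `s - ξ_n(x)`. By rigidity `T^{h_n} x` may be replaced by `x`. Moreover `ξ_n ∘ T - ξ_n = f ∘
T^{h_n} - f` on `C_n ∩ T⁻¹ C_n`, and this is small in `L¹`, so `ξ_n` is asymptotically invariant.
Ergodicity then makes bounded Lipschitz functions of `ξ_n` asymptotically independent of every fixed
function (`Ergodic.tendsto_integral_mul_sub`). Hence the correlation of `g` at time `c_n + s` is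
close to the average over `u ∼ P_n` of its correlation at time `s - u`. This is proved after
smoothing in `s` by `e^{-|s-t|}`, which turns the shift by `ξ_n` into a Lipschitz function of `ξ_n`
(`tendsto_correlationDefect`).

On the spectral side (`correlationDefect_eq_integral`) this says that `κ(v) (e^{i c_n v} - p_n(v))`
tends to zero weakly in `L²(σ)`, where `p_n(v)` is the characteristic function of `P_n` at `-v` and
`κ(v) = 2 / (1 + v²) > 0`. The exponential tails give tightness, and along a subsequence `p_n`
converges pointwise to some `q`. The limit law has exponential tails too, so its characteristic
function extends analytically to a strip and `q` has only countably many zeros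
(`exists_subseq_tendsto_charFun_of_tail`).

Since `f` is bounded below, `c_n → ∞`. If `τ` is Lebesgue measure, or the spectral measure of a
mean-zero function for a mixing flow, then `e^{i c_n v}` tends weakly to zero on `τ` and `τ` has no
atoms. On the part of `σ` absolutely continuous with respect to `τ`, the weak limit of `e^{i c_n v}`
would be both `q` and zero. As `q ≠ 0` holds `τ`-almost everywhere, that part vanishes
(`mutuallySingular_of_exp_asymptotics`). -/

theorem tendsto_inner_zero_of_total {H ι : Type*} [NormedAddCommGroup H] [InnerProductSpace ℂ H]
    [CompleteSpace H] {l : Filter ι} {U : ι → H} {M : ℝ} (hM : ∀ i, ‖U i‖ ≤ M) {D : Set H}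
    (hD : ∀ e ∈ D, Tendsto (fun i => inner ℂ (U i) e) l (𝓝 0))
    (htotal : ∀ a : H, (∀ e ∈ D, inner ℂ e a = 0) → a = 0) (y : H) :
    Tendsto (fun i => inner ℂ (U i) y) l (𝓝 0) := by
  let S : Submodule ℂ H :=
    { carrier := {y | Tendsto (fun i => inner ℂ (U i) y) l (𝓝 0)}
      add_mem' := by
        intro a b ha hb
        simpa [inner_add_right] using ha.add hb
      zero_mem' := by simpa using tendsto_const_nhds
      smul_mem' := by
        intro z a ha
        simpa [inner_smul_right] using ha.const_mul z }
  -- The uniform bound on `‖U i‖` makes the subspace closed; totality then forces its orthogonal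
  -- complement to be zero. Using `|M| + 1` keeps the denominator positive.
  have hclosed : IsClosed (S : Set H) := by
    refine isClosed_of_closure_subset fun a ha => ?_
    change Tendsto _ _ _
    rw [Metric.tendsto_nhds]
    intro ε hε
    have hM0 : 0 < |M| + 1 := by positivity
    obtain ⟨b, hb, hab⟩ := Metric.mem_closure_iff.1 ha (ε / (2 * (|M| + 1))) (by positivity)
    filter_upwards [Metric.tendsto_nhds.1 hb (ε / 2) (by positivity)] with i hi
    rw [dist_zero_right] at hi ⊢
    have e : inner ℂ (U i) a = inner ℂ (U i) (a - b) + inner ℂ (U i) b := by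
      rw [← inner_add_right]; simp
    have h1 : ‖inner ℂ (U i) (a - b)‖ ≤ ε / 2 := by
      refine (norm_inner_le_norm _ _).trans ?_
      rw [dist_eq_norm] at hab
      calc ‖U i‖ * ‖a - b‖ ≤ (|M| + 1) * (ε / (2 * (|M| + 1))) := by
            gcongr
            exact (hM i).trans (by linarith [le_abs_self M])
        _ = ε / 2 := by field_simp
    rw [e]
    linarith [norm_add_le (inner ℂ (U i) (a - b)) (inner ℂ (U i) b)]
  have : CompleteSpace S := hclosed.completeSpace_coe
  have hS : S = ⊤ := by
    rw [← Submodule.orthogonal_eq_bot_iff, Submodule.eq_bot_iff]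
    intro a ha
    exact htotal a fun e he => (Submodule.mem_orthogonal S a).1 ha e (hD e he)
  have : y ∈ S := hS ▸ Submodule.mem_top
  exact this

theorem inner_toLp {α : Type*} [MeasurableSpace α] {ν : Measure α} {a b : α → ℂ}
    (ha : MemLp a 2 ν) (hb : MemLp b 2 ν) :
    inner ℂ (ha.toLp a) (hb.toLp b) = ∫ x, b x * conj (a x) ∂ν := by
  rw [L2.inner_def]
  refine integral_congr_ae ?_
  filter_upwards [ha.coeFn_toLp, hb.coeFn_toLp] with x h1 h2
  simp [h1, h2]

theorem MeasureTheory.MemLp.conj {α : Type*} [MeasurableSpace α] {ν : Measure α} {a : α → ℂ}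
    {p : ℝ≥0∞} (ha : MemLp a p ν) : MemLp (fun x => conj (a x)) p ν :=
  ha.of_le (Complex.continuous_conj.comp_aestronglyMeasurable ha.1) (ae_of_all _ fun x => by simp)

/-- On a finite measure space uniform boundedness gives an `L²` bound, and conjugating `u i` turns
the bilinear pairing into an inner product. The total families it serves are the characters, the
indicators, and the constants together with the coboundaries of indicators. -/
theorem tendsto_integral_mul_zero_of_total {α ι : Type*} [MeasurableSpace α] {ν : Measure α}
    [IsFiniteMeasure ν] {l : Filter ι} {u : ι → α → ℂ} {B : ℝ}
    (hu : ∀ i, AEStronglyMeasurable (u i) ν) (hB : ∀ i x, ‖u i x‖ ≤ B) {D : Set (α → ℂ)}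
    (hD : ∀ e ∈ D, MemLp e 2 ν)
    (hlim : ∀ e ∈ D, Tendsto (fun i => ∫ x, e x * u i x ∂ν) l (𝓝 0))
    (htotal : ∀ a : α → ℂ, MemLp a 2 ν → (∀ e ∈ D, ∫ x, a x * conj (e x) ∂ν = 0) → a =ᵐ[ν] 0)
    {y : α → ℂ} (hy : MemLp y 2 ν) : Tendsto (fun i => ∫ x, y x * u i x ∂ν) l (𝓝 0) := by
  have hmem : ∀ i, MemLp (fun x => conj (u i x)) 2 ν := fun i =>
    MemLp.of_bound (Complex.continuous_conj.comp_aestronglyMeasurable (hu i)) B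
      (ae_of_all _ fun x => by simpa using hB i x)
  have key := tendsto_inner_zero_of_total (l := l) (U := fun i => (hmem i).toLp _)
    (M := (measureUnivNNReal ν : ℝ) ^ (2 : ℝ≥0∞).toReal⁻¹ * |B|)
    (D := {E | ∃ e, ∃ h : e ∈ D, E = (hD e h).toLp e}) ?_ ?_ ?_ (hy.toLp y)
  · simpa [inner_toLp] using key
  · intro i
    refine Lp.norm_le_of_ae_bound (abs_nonneg B) ?_
    filter_upwards [(hmem i).coeFn_toLp] with x hx
    rw [hx]
    simpa using (hB i x).trans (le_abs_self B)
  · rintro _ ⟨e, he, rfl⟩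
    simpa [inner_toLp] using hlim e he
  · intro a ha
    rw [Lp.eq_zero_iff_ae_eq_zero]
    refine htotal a (Lp.memLp a) fun e he => ?_
    rw [← inner_toLp (hD e he) (Lp.memLp a), Lp.toLp_coeFn]
    exact ha _ ⟨e, he, rfl⟩

/-! ### Totality of the characters in `L²` of a finite measure -/

/-- The positive and negative parts of `x` are densities of two finite measures with the same
characteristic function, so these measures coincide. -/
theorem ae_eq_zero_of_integral_exp_mul_ofReal {σ : Measure ℝ} {x : ℝ → ℝ} (hx : Integrable x σ)
    (h : ∀ t : ℝ, ∫ v, Complex.exp (Complex.I * t * v) * (x v : ℂ) ∂σ = 0) : x =ᵐ[σ] 0 := by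
  have hpos : AEMeasurable (fun v => ENNReal.ofReal (x v)) σ := hx.1.aemeasurable.ennreal_ofReal
  have hneg : AEMeasurable (fun v => ENNReal.ofReal (-x v)) σ :=
    hx.1.aemeasurable.neg.ennreal_ofReal
  have := isFiniteMeasure_withDensity_ofReal hx.2
  have := isFiniteMeasure_withDensity_ofReal hx.neg.2
  have hexp : ∀ t : ℝ, ∀ {z : ℝ → ℝ}, Integrable z σ →
      Integrable (fun v : ℝ => (z v : ℂ) * Complex.exp (t * v * Complex.I)) σ := by
    intro t z hz
    refine hz.ofReal.mul_bdd (c := 1) (by fun_prop) (ae_of_all _ fun v => ?_)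
    rw [← Complex.ofReal_mul, Complex.norm_exp_ofReal_mul_I]
  have key : σ.withDensity (fun v => ENNReal.ofReal (x v))
      = σ.withDensity (fun v => ENNReal.ofReal (-x v)) := by
    refine Measure.ext_of_charFun (funext fun t => ?_)
    rw [charFun_apply_real, charFun_apply_real,
      integral_withDensity_eq_integral_toReal_smul₀ hpos (by simp),
      integral_withDensity_eq_integral_toReal_smul₀ hneg (by simp), ← sub_eq_zero,
      ← integral_sub]
    · rw [← h t]
      refine integral_congr_ae (ae_of_all _ fun v => ?_)
      simp only [ENNReal.toReal_ofReal', Complex.real_smul]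
      rw [← sub_mul, ← Complex.ofReal_sub, max_zero_sub_max_neg_zero_eq_self, mul_comm]
      congr 2
      ring
    · simpa only [ENNReal.toReal_ofReal', Complex.real_smul] using hexp t hx.pos_part
    · simpa only [ENNReal.toReal_ofReal', Complex.real_smul, Pi.neg_apply] using hexp t hx.neg.pos_part
  rw [withDensity_eq_iff hpos hneg hx.lintegral_lt_top.ne] at key
  filter_upwards [key] with v hv
  rcases le_total (x v) 0 with h0 | h0
  · rw [ENNReal.ofReal_of_nonpos h0, eq_comm, ENNReal.ofReal_eq_zero] at hv
    exact le_antisymm h0 (neg_nonpos.1 hv)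
  · rw [ENNReal.ofReal_of_nonpos (p := -x v) (by linarith), ENNReal.ofReal_eq_zero] at hv
    exact le_antisymm hv h0

theorem norm_exp_I_mul_mul (t v : ℝ) : ‖Complex.exp (Complex.I * t * v)‖ = 1 := by
  have : Complex.I * t * v = ((t * v : ℝ) : ℂ) * Complex.I := by push_cast; ring
  rw [this, Complex.norm_exp_ofReal_mul_I]

theorem conj_exp_I_mul_mul (t v : ℝ) :
    conj (Complex.exp (Complex.I * t * v)) = Complex.exp (Complex.I * ((-t : ℝ) : ℂ) * v) := by
  rw [← Complex.exp_conj]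
  simp

/-- Conjugating the relation at `-t` gives the relation at `t` for `conj a`, so the real and
imaginary parts can be treated separately. -/
theorem ae_eq_zero_of_integral_exp_mul {σ : Measure ℝ} {a : ℝ → ℂ} (ha : Integrable a σ)
    (h : ∀ t : ℝ, ∫ v, Complex.exp (Complex.I * t * v) * a v ∂σ = 0) : a =ᵐ[σ] 0 := by
  have hexp : ∀ t : ℝ, ∀ {z : ℝ → ℂ}, Integrable z σ →
      Integrable (fun v : ℝ => Complex.exp (Complex.I * t * v) * z v) σ := by
    intro t z hz
    refine hz.bdd_mul (c := 1) (by fun_prop) (ae_of_all _ fun v => ?_)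
    rw [norm_exp_I_mul_mul]
  have hac : Integrable (fun v => conj (a v)) σ :=
    ⟨Complex.continuous_conj.comp_aestronglyMeasurable ha.1, by
      simpa [HasFiniteIntegral, enorm_eq_nnnorm] using ha.2⟩
  have hconj : ∀ t : ℝ, ∫ v, Complex.exp (Complex.I * t * v) * conj (a v) ∂σ = 0 := by
    intro t
    have := congrArg conj (h (-t))
    rw [← integral_conj, map_zero] at this
    rw [← this]
    refine integral_congr_ae (ae_of_all _ fun v => ?_)
    simp [← Complex.exp_conj]
  have hre : (fun v => (a v).re) =ᵐ[σ] 0 := by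
    refine ae_eq_zero_of_integral_exp_mul_ofReal ha.re fun t => ?_
    have := congrArg₂ (· + ·) (h t) (hconj t)
    simp only [← integral_add (hexp t ha) (hexp t hac), ← mul_add, Complex.add_conj] at this
    simpa [mul_left_comm _ (2 : ℂ), integral_const_mul] using this
  have him : (fun v => (a v).im) =ᵐ[σ] 0 := by
    refine ae_eq_zero_of_integral_exp_mul_ofReal ha.im fun t => ?_
    have := congrArg₂ (· - ·) (h t) (hconj t)
    simp only [← integral_sub (hexp t ha) (hexp t hac), ← mul_sub, Complex.sub_conj] at this
    have h2 : ∫ v, Complex.exp (Complex.I * t * v) * (a v).im * (2 * Complex.I) ∂σ = 0 := by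
      rw [← sub_zero (0 : ℂ), ← this]
      refine integral_congr_ae (ae_of_all _ fun v => ?_)
      push_cast
      ring
    rw [integral_mul_const] at h2
    simpa using h2
  filter_upwards [hre, him] with v h1 h2
  exact Complex.ext h1 h2

theorem tendsto_integral_mul_zero_of_exp {ι : Type*} {σ : Measure ℝ} [IsFiniteMeasure σ]
    {l : Filter ι} {u : ι → ℝ → ℂ} {B : ℝ} (hu : ∀ i, AEStronglyMeasurable (u i) σ)
    (hB : ∀ i x, ‖u i x‖ ≤ B)
    (hlim : ∀ t : ℝ, Tendsto (fun i => ∫ v, Complex.exp (Complex.I * t * v) * u i v ∂σ) l (𝓝 0))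
    {y : ℝ → ℂ} (hy : MemLp y 2 σ) : Tendsto (fun i => ∫ x, y x * u i x ∂σ) l (𝓝 0) := by
  refine tendsto_integral_mul_zero_of_total hu hB
    (D := Set.range fun (t v : ℝ) => Complex.exp (Complex.I * t * v)) ?_ ?_ ?_ hy
  · rintro _ ⟨t, rfl⟩
    exact MemLp.of_bound (by fun_prop) 1 (ae_of_all _ fun v => (norm_exp_I_mul_mul t v).le)
  · rintro _ ⟨t, rfl⟩
    exact hlim t
  · intro a ha h
    refine ae_eq_zero_of_integral_exp_mul (ha.integrable one_le_two) fun t => ?_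
    rw [← h _ ⟨-t, rfl⟩]
    refine integral_congr_ae (ae_of_all _ fun v => ?_)
    beta_reduce
    rw [conj_exp_I_mul_mul, neg_neg, mul_comm]

/-! ### Singularity criterion from the asymptotics of characters -/

/-- A finite measure `σ` for which the characters `e^{i c_n v}` behave weakly like functions with
an almost nowhere vanishing limit is singular to every measure on which they tend to zero. -/
theorem mutuallySingular_of_exp_asymptotics {σ τ : Measure ℝ} [IsFiniteMeasure σ] [SigmaFinite τ]
    [NullSingletonClass τ] {c : ℕ → ℝ} {κ : ℝ → ℝ} (hκ : Measurable κ) (hκ_pos : ∀ v, 0 < κ v)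
    {M : ℝ} (hκM : ∀ v, κ v ≤ M) {p : ℕ → ℝ → ℂ} (hp : ∀ n, Measurable (p n))
    (hp1 : ∀ n v, ‖p n v‖ ≤ 1) {q : ℝ → ℂ} (hpq : ∀ v, Tendsto (fun n => p n v) atTop (𝓝 (q v)))
    (hq : {v | q v = 0}.Countable)
    (hσ : ∀ t : ℝ, Tendsto (fun n => ∫ v, Complex.exp (Complex.I * t * v) *
      (κ v * (Complex.exp (Complex.I * c n * v) - p n v)) ∂σ) atTop (𝓝 0))
    (hτ : ∀ y : ℝ → ℂ, Integrable y τ → MemLp y 2 τ →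
      Tendsto (fun n => ∫ v, Complex.exp (Complex.I * c n * v) * y v ∂τ) atTop (𝓝 0)) :
    σ ⟂ₘ τ := by
  have hM : 0 < M := (hκ_pos 0).trans_le (hκM 0)
  have hq_meas : Measurable q := measurable_of_tendsto_metrizable hp (tendsto_pi_nhds.2 hpq)
  have hq1 : ∀ v, ‖q v‖ ≤ 1 := fun v =>
    le_of_tendsto (hpq v).norm (Eventually.of_forall fun n => hp1 n v)
  set r : ℝ → ℝ := fun v => (σ.rnDeriv τ v).toReal with hr_def
  have hr_meas : Measurable r := (Measure.measurable_rnDeriv σ τ).ennreal_toReal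
  have hr0 : ∀ v, 0 ≤ r v := fun v => ENNReal.toReal_nonneg
  have hr_int : Integrable r τ := Measure.integrable_toReal_rnDeriv
  obtain ⟨A, hA, hA1, hA2⟩ := Measure.mutuallySingular_singularPart σ τ
  -- `A` carries all of `τ` and none of the singular part, so restricting to `A` isolates the
  -- absolutely continuous part of `σ`.
  have hσA : σ.restrict A = τ.withDensity (σ.rnDeriv τ) := by
    conv_lhs => rw [← Measure.singularPart_add_rnDeriv σ τ]
    rw [Measure.restrict_add, Measure.restrict_eq_zero.2 hA1, zero_add]
    refine Measure.restrict_eq_self_of_ae_mem ?_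
    exact (withDensity_absolutelyContinuous τ _).ae_le (mem_ae_iff.2 hA2)
  -- The factor `conj q` will produce `|q|²` in the limit. Dividing by `1 + r` keeps `m` and `r * m`
  -- bounded, so that `m` may be tested on `σ` and `κ * r * m` on `τ`.
  set m : ℝ → ℂ := fun v => conj (q v) / (1 + r v) with hm_def
  have hm_meas : Measurable m := by fun_prop
  have hnorm : ∀ v, ‖(1 + r v : ℂ)‖ = 1 + r v := fun v => by
    rw [← Complex.ofReal_one, ← Complex.ofReal_add, Complex.norm_of_nonneg (by linarith [hr0 v])]
  have hm1 : ∀ v, ‖m v‖ ≤ 1 := fun v => by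
    rw [hm_def, norm_div, hnorm, RCLike.norm_conj]
    exact div_le_one_of_le₀ ((hq1 v).trans (by linarith [hr0 v])) (by linarith [hr0 v])
  have hy : MemLp (A.indicator m) 2 σ :=
    MemLp.of_bound (hm_meas.indicator hA).aestronglyMeasurable 1 (ae_of_all _ fun v =>
      (norm_indicator_le_norm_self _ _).trans (hm1 v))
  have h1 : Tendsto (fun n => ∫ v, A.indicator m v *
      (κ v * (Complex.exp (Complex.I * c n * v) - p n v)) ∂σ) atTop (𝓝 0) := by
    refine tendsto_integral_mul_zero_of_exp (B := M * 2) (fun n => ?_) (fun n v => ?_) hσ hy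
    · have := hp n
      exact Measurable.aestronglyMeasurable (by fun_prop)
    · rw [norm_mul, Complex.norm_of_nonneg (hκ_pos v).le]
      gcongr
      · exact hκM v
      · refine (norm_sub_le _ _).trans ?_
        rw [norm_exp_I_mul_mul]
        linarith [hp1 n v]
  set H : ℝ → ℂ := fun v => (κ v * r v : ℝ) * m v with hH_def
  have hH_meas : Measurable H := by fun_prop
  have hHr : ∀ v, ‖H v‖ ≤ M * r v := fun v => by
    rw [hH_def, norm_mul, Complex.norm_of_nonneg (mul_nonneg (hκ_pos v).le (hr0 v)),
      ← mul_one (M * r v)]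
    have := hκM v
    have := hm1 v
    have := hr0 v
    gcongr
  have hHM : ∀ v, ‖H v‖ ≤ M := fun v => by
    have h0 := hr0 v
    have h2 : r v * ‖m v‖ ≤ 1 := by
      rw [hm_def, norm_div, hnorm, RCLike.norm_conj, mul_div_assoc']
      refine div_le_one_of_le₀ ?_ (by linarith)
      nlinarith [hq1 v, norm_nonneg (q v)]
    rw [hH_def, norm_mul, Complex.norm_of_nonneg (mul_nonneg (hκ_pos v).le (hr0 v)), mul_assoc,
      ← mul_one M]
    exact mul_le_mul (hκM v) h2 (by positivity) hM.le
  have hH_int : Integrable H τ := (hr_int.const_mul M).mono' hH_meas.aestronglyMeasurable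
    (ae_of_all _ hHr)
  have hH2 : MemLp H 2 τ := by
    rw [memLp_two_iff_integrable_sq_norm hH_meas.aestronglyMeasurable]
    refine (hH_int.norm.const_mul M).mono' (by fun_prop) (ae_of_all _ fun v => ?_)
    rw [Real.norm_of_nonneg (by positivity), sq]
    exact mul_le_mul_of_nonneg_right (hHM v) (norm_nonneg _)
  have hpH : ∀ n, Integrable (fun v => p n v * H v) τ := fun n =>
    hH_int.bdd_mul (hp n).aestronglyMeasurable (ae_of_all _ (hp1 n))
  have h2 : ∀ n, ∫ v, A.indicator m v * (κ v * (Complex.exp (Complex.I * c n * v) - p n v)) ∂σ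
      = ∫ v, Complex.exp (Complex.I * c n * v) * H v ∂τ - ∫ v, p n v * H v ∂τ := by
    intro n
    rw [← integral_sub (hH_int.bdd_mul (c := 1) (by fun_prop) (ae_of_all _ fun v =>
      (norm_exp_I_mul_mul _ v).le)) (hpH n)]
    have : (fun v => A.indicator m v * (κ v * (Complex.exp (Complex.I * c n * v) - p n v)))
        = A.indicator fun v => m v * (κ v * (Complex.exp (Complex.I * c n * v) - p n v)) := by
      funext v
      by_cases hv : v ∈ A <;> simp [hv]
    rw [this, integral_indicator hA, hσA,
      integral_withDensity_eq_integral_toReal_smul (Measure.measurable_rnDeriv σ τ)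
        (Measure.rnDeriv_lt_top σ τ)]
    refine integral_congr_ae (ae_of_all _ fun v => ?_)
    simp only [hH_def, hr_def, Complex.real_smul]
    push_cast
    ring
  have h3 : Tendsto (fun n => ∫ v, p n v * H v ∂τ) atTop (𝓝 (∫ v, q v * H v ∂τ)) := by
    refine tendsto_integral_of_dominated_convergence (fun v => ‖H v‖)
      (fun n => (hpH n).1) hH_int.norm (fun n => ae_of_all _ fun v => ?_)
      (ae_of_all _ fun v => (hpq v).mul_const _)
    rw [norm_mul]
    exact mul_le_of_le_one_left (norm_nonneg _) (hp1 n v)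
  -- The integrals over `σ` tend to zero by hypothesis; written over `τ`, their character term dies
  -- by `hτ` and only `-∫ q H` survives.
  have h4 : ∫ v, q v * H v ∂τ = 0 := by
    have := tendsto_nhds_unique h1 (((hτ H hH_int hH2).sub h3).congr fun n => (h2 n).symm)
    simpa using this.symm
  have h5 : ∀ v, q v * H v = ((κ v * (r v / (1 + r v)) * ‖q v‖ ^ 2 : ℝ) : ℂ) := fun v => by
    have := Complex.mul_conj' (q v)
    simp only [hH_def, hm_def]
    push_cast
    rw [← this]
    ring
  simp only [h5] at h4
  rw [integral_complex_ofReal, Complex.ofReal_eq_zero, integral_eq_zero_iff_of_nonneg] at h4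
  · rw [← Measure.rnDeriv_eq_zero]
    -- Since `τ` has no atoms, the countable zero set of `q` is negligible, and the remaining
    -- factors force the density to vanish.
    filter_upwards [h4, hq.ae_notMem τ, Measure.rnDeriv_lt_top σ τ] with v hv hqv hlt
    simp only [Pi.zero_apply, mul_eq_zero, div_eq_zero_iff, pow_eq_zero_iff, norm_eq_zero, ne_eq,
      OfNat.ofNat_ne_zero, not_false_eq_true] at hv
    rcases hv with (hv | hv | hv) | hv
    · exact absurd hv (hκ_pos v).ne'
    · exact ((ENNReal.toReal_eq_zero_iff _).1 hv).resolve_right hlt.ne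
    · linarith [hr0 v]
    · exact absurd hv hqv
  · intro v
    have := hκ_pos v
    have := hr0 v
    positivity
  · have : Integrable (fun v => q v * H v) τ :=
      hH_int.bdd_mul hq_meas.aestronglyMeasurable (ae_of_all _ hq1)
    simp only [h5] at this
    simpa only [RCLike.re_to_complex, Complex.ofReal_re] using this.re

theorem tendsto_integral_exp_mul_volume {c : ℕ → ℝ} (hc : Tendsto c atTop atTop) (y : ℝ → ℂ) :
    Tendsto (fun n => ∫ v : ℝ, Complex.exp (Complex.I * c n * v) * y v) atTop (𝓝 0) := by
  -- Riemann–Lebesgue at frequency `-c n / (2π)`, because the Fourier kernel there is `e^{-2πi w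
  -- v}`.
  have h := (Real.tendsto_integral_exp_smul_cocompact y).comp
    ((tendsto_neg_atTop_atBot.comp (hc.atTop_div_const Real.two_pi_pos)).mono_right
      atBot_le_cocompact)
  refine h.congr fun n => ?_
  refine integral_congr_ae (ae_of_all _ fun v => ?_)
  simp only [Function.comp_apply, Circle.smul_def, smul_eq_mul, Real.fourierChar_apply]
  congr 2
  push_cast
  field_simp

/-- Multiplying by `e^{itv}` only shifts the frequency by `t`, so decay of the Fourier transform of
`τ` along every shift of `c` gives convergence on the total family of characters. -/
theorem tendsto_integral_exp_mul_of_fourier {τ : Measure ℝ} [IsFiniteMeasure τ] {c : ℕ → ℝ}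
    (h : ∀ t : ℝ, Tendsto (fun n => ∫ v : ℝ, Complex.exp (Complex.I * ((c n + t : ℝ) : ℂ) * v) ∂τ) atTop (𝓝 0))
    {y : ℝ → ℂ} (hy : MemLp y 2 τ) :
    Tendsto (fun n => ∫ v : ℝ, Complex.exp (Complex.I * c n * v) * y v ∂τ) atTop (𝓝 0) := by
  have := tendsto_integral_mul_zero_of_exp (σ := τ) (B := 1) (l := atTop)
    (u := fun n v => Complex.exp (Complex.I * c n * v)) (fun n => by fun_prop)
    (fun n v => (norm_exp_I_mul_mul _ v).le) (fun t => (h t).congr fun n => ?_) hy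
  · simpa only [mul_comm] using this
  · refine integral_congr_ae (ae_of_all _ fun v => ?_)
    simp only [← Complex.exp_add]
    congr 1
    push_cast
    ring

/-- Tested against the indicator of `{s}`, the integral has modulus `τ {s}` for every `n`. -/
theorem nullSingletonClass_of_exp_tendsto_zero {τ : Measure ℝ} [IsFiniteMeasure τ] {c : ℕ → ℝ}
    (h : ∀ y : ℝ → ℂ, MemLp y 2 τ →
      Tendsto (fun n => ∫ v : ℝ, Complex.exp (Complex.I * c n * v) * y v ∂τ) atTop (𝓝 0)) :
    NullSingletonClass τ := by
  refine ⟨fun s => ?_⟩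
  have h1 := (h (Set.indicator {s} 1) ((memLp_const 1).indicator (measurableSet_singleton s))).norm
  have h2 : ∀ n, ‖∫ v : ℝ, Complex.exp (Complex.I * c n * v) * Set.indicator {s} 1 v ∂τ‖
      = τ.real {s} := by
    intro n
    have : (fun v : ℝ => Complex.exp (Complex.I * c n * v) * Set.indicator {s} (1 : ℝ → ℂ) v)
        = Set.indicator {s} fun v : ℝ => Complex.exp (Complex.I * c n * v) := by
      funext v
      by_cases hv : v ∈ ({s} : Set ℝ) <;> simp [hv]
    rw [this, integral_indicator (measurableSet_singleton s), integral_singleton, norm_smul,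
      norm_exp_I_mul_mul]
    simp
  simp only [h2, norm_zero] at h1
  have h3 := tendsto_nhds_unique h1 tendsto_const_nhds
  rwa [eq_comm, measureReal_eq_zero_iff] at h3

/-! ### Mixing flows -/

namespace IsMeasurePreservingFlow

variable {Z : Type*} [MeasurableSpace Z] {R : ℝ → Z → Z} {ρ : Measure Z}

/-- The time `t` map of a measurable flow. -/
def measurableEquiv (hR : IsMeasurePreservingFlow R ρ) (t : ℝ) : Z ≃ᵐ Z where
  toFun := R t
  invFun := R (-t)
  left_inv z := by rw [← hR.map_add, neg_add_cancel, hR.map_zero]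
  right_inv z := by rw [← hR.map_add, add_neg_cancel, hR.map_zero]
  measurable_toFun := (hR.preserving t).measurable
  measurable_invFun := (hR.preserving (-t)).measurable

theorem integral_comp_mul (hR : IsMeasurePreservingFlow R ρ) (t : ℝ) (a b : Z → ℂ) :
    ∫ z, a (R t z) * b z ∂ρ = ∫ z, a z * b (R (-t) z) ∂ρ := by
  have h : MeasurePreserving (hR.measurableEquiv t) ρ ρ := hR.preserving t
  rw [← h.integral_comp' fun z => a z * b (R (-t) z)]
  refine integral_congr_ae (ae_of_all _ fun z => ?_)
  have : R (-t) (R t z) = z := (hR.measurableEquiv t).left_inv z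
  change _ = a (R t z) * b (R (-t) (R t z))
  rw [this]

end IsMeasurePreservingFlow

namespace IsMixingFlow

variable {Z : Type*} [MeasurableSpace Z] {R : ℝ → Z → Z} {ρ : Measure Z} [IsProbabilityMeasure ρ]

/-- Mixing says that `1_A ∘ R_t - ρ(A)` tends to zero against indicators, hence weakly in `L²`; the
constant `ρ(A)` is invisible to the mean-zero function `b`. -/
theorem tendsto_setIntegral_comp (hR : IsMixingFlow R ρ) {A : Set Z} (hA : MeasurableSet A)
    {b : Z → ℂ} (hb : MemLp b 2 ρ) (hb0 : ∫ z, b z ∂ρ = 0) :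
    Tendsto (fun t => ∫ z, A.indicator 1 (R t z) * b z ∂ρ) atTop (𝓝 0) := by
  have hmeas : ∀ t, Measurable fun z => A.indicator (1 : Z → ℂ) (R t z) := fun t =>
    (measurable_one.indicator hA).comp (hR.preserving t).measurable
  have hbd : ∀ t z, ‖A.indicator (1 : Z → ℂ) (R t z)‖ ≤ 1 := fun t z =>
    (norm_indicator_le_norm_self _ _).trans (by simp)
  have key := tendsto_integral_mul_zero_of_total (ν := ρ) (l := atTop) (B := 2)
    (u := fun t z => A.indicator 1 (R t z) - (ρ.real A : ℂ))
    (fun t => ((hmeas t).sub_const _).aestronglyMeasurable) (fun t z => ?_)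
    (D := {e | ∃ S, MeasurableSet S ∧ e = S.indicator 1}) ?_ ?_ ?_ hb
  · refine key.congr fun t => ?_
    simp only [mul_sub]
    rw [integral_sub, integral_mul_const, hb0, zero_mul, sub_zero]
    · simp only [mul_comm]
    · exact (hb.integrable one_le_two).mul_bdd (hmeas t).aestronglyMeasurable (ae_of_all _ (hbd t))
    · exact (hb.integrable one_le_two).mul_const _
  · refine (norm_sub_le _ _).trans ?_
    have : ‖(ρ.real A : ℂ)‖ ≤ 1 := by
      rw [Complex.norm_of_nonneg measureReal_nonneg]
      exact measureReal_le_one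
    linarith [hbd t z]
  · rintro _ ⟨S, hS, rfl⟩
    exact (memLp_const 1).indicator hS
  · rintro _ ⟨S, hS, rfl⟩
    have h1 : ∀ t, ∫ z, S.indicator 1 z * (A.indicator 1 (R t z) - (ρ.real A : ℂ)) ∂ρ
        = ((ρ.real (S ∩ R t ⁻¹' A) - ρ.real S * ρ.real A : ℝ) : ℂ) := by
      intro t
      have hSA : MeasurableSet (S ∩ R t ⁻¹' A) := hS.inter ((hR.preserving t).measurable hA)
      have h2 : ∀ z, S.indicator 1 z * (A.indicator 1 (R t z) - (ρ.real A : ℂ))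
          = (S ∩ R t ⁻¹' A).indicator (fun _ => 1) z - S.indicator (fun _ => (ρ.real A : ℂ)) z := by
        intro z
        by_cases hz : z ∈ S <;> by_cases hz' : R t z ∈ A <;> simp [hz, hz']
      simp only [h2]
      rw [integral_sub ((integrable_const (1 : ℂ)).indicator hSA)
        ((integrable_const _).indicator hS), integral_indicator hSA, integral_indicator hS]
      simp
    simp only [h1]
    rw [← Complex.ofReal_zero]
    refine (Complex.continuous_ofReal.tendsto 0).comp ?_
    have h3 := (ENNReal.tendsto_toReal (by finiteness)).comp (hR.mixing S A hS hA)
    rw [ENNReal.toReal_mul] at h3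
    simpa [Measure.real, Function.comp_def] using h3.sub_const ((ρ S).toReal * (ρ A).toReal)
  · intro a ha h
    refine (ha.integrable one_le_two).ae_eq_zero_of_forall_setIntegral_eq_zero fun S hS _ => ?_
    rw [← integral_indicator hS, ← h _ ⟨S, hS, rfl⟩]
    refine integral_congr_ae (ae_of_all _ fun z => ?_)
    by_cases hz : z ∈ S <;> simp [hz]

/-- A second density argument: moving the flow to the conjugated factor leaves vectors `k ∘ R_{-t}`
of constant norm, which need only be tested on indicators. -/
theorem tendsto_correlation (hR : IsMixingFlow R ρ) {k : Z → ℂ} (hk : MemLp k 2 ρ)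
    (hk0 : ∫ z, k z ∂ρ = 0) :
    Tendsto (fun t => ∫ z, k (R t z) * conj (k z) ∂ρ) atTop (𝓝 0) := by
  have hkt : ∀ t, MemLp (fun z => k (R (-t) z)) 2 ρ := fun t =>
    hk.comp_measurePreserving (hR.preserving (-t))
  have hkc : ∫ z, conj (k z) ∂ρ = 0 := by rw [integral_conj, hk0, map_zero]
  have key := tendsto_inner_zero_of_total (l := atTop) (U := fun t => (hkt t).toLp _)
    (M := ‖hk.toLp k‖) (fun t => ?_)
    (D := {E | ∃ S, ∃ hS : MeasurableSet S,
      E = ((memLp_const (1 : ℂ)).indicator hS : MemLp (S.indicator fun _ => (1 : ℂ)) 2 ρ).toLp _})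
    ?_ ?_ (hk.toLp k)
  · refine key.congr fun t => ?_
    rw [inner_toLp, hR.integral_comp_mul t k fun z => conj (k z)]
  · rw [Lp.norm_toLp, Lp.norm_toLp]
    exact (congrArg _ (eLpNorm_comp_measurePreserving hk.1 (hR.preserving (-t)))).le
  · rintro _ ⟨S, hS, rfl⟩
    refine (hR.tendsto_setIntegral_comp hS hk.conj hkc).congr fun t => ?_
    rw [inner_toLp, hR.integral_comp_mul t _ fun z => conj (k z)]
    rfl
  · intro a ha
    rw [Lp.eq_zero_iff_ae_eq_zero]
    refine ((Lp.memLp a).integrable one_le_two).ae_eq_zero_of_forall_setIntegral_eq_zero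
      fun S hS _ => ?_
    have h := ha _ ⟨S, hS, rfl⟩
    conv at h => lhs; rw [← Lp.toLp_coeFn a (Lp.memLp a)]
    rw [inner_toLp] at h
    rw [← integral_indicator hS, ← h]
    refine integral_congr_ae (ae_of_all _ fun z => ?_)
    by_cases hz : z ∈ S <;> simp [hz]

end IsMixingFlow

/-! ### Rigidity and asymptotic independence -/

section Ergodic

variable {X : Type*} [MeasurableSpace X] {μ : Measure X}

theorem IsRigiditySequence.tendsto_measure_preimage [IsProbabilityMeasure μ] {T : X ≃ᵐ X}
    (hT : MeasurePreserving T μ μ) {h : ℕ → ℕ} (hh : IsRigiditySequence T μ h) {A : Set X}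
    (hA : MeasurableSet A) : Tendsto (fun n => μ (symmDiff (T^[h n] ⁻¹' A) A)) atTop (𝓝 0) := by
  refine (hh.2 A hA).congr fun n => ?_
  have hTn : MeasurePreserving T^[h n] μ μ := hT.iterate _
  have hA' : MeasurableSet (T^[h n] '' A) := by
    have : T^[h n] '' A = (T.symm)^[h n] ⁻¹' A :=
      congrFun (Set.image_eq_preimage_of_inverse (T.left_inv.iterate _) (T.right_inv.iterate _)) A
    rw [this]
    exact (T.symm.measurable.iterate _) hA
  rw [← hTn.measure_preimage (hA.symmDiff hA').nullMeasurableSet, Set.preimage_symmDiff,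
    Set.preimage_image_eq _ (T.injective.iterate _)]

/-- Rigidity is this statement for indicators. It extends to `L¹` by density, since composition with
`T^{h n}` is an `L¹` isometry. -/
theorem IsRigiditySequence.tendsto_integral_norm_sub [IsProbabilityMeasure μ] {T : X ≃ᵐ X}
    (hT : MeasurePreserving T μ μ) {h : ℕ → ℕ} (hh : IsRigiditySequence T μ h)
    {E : Type*} [NormedAddCommGroup E] {a : X → E} (ha : Integrable a μ) :
    Tendsto (fun n => ∫ x, ‖a (T^[h n] x) - a x‖ ∂μ) atTop (𝓝 0) := by
  have hcomp : ∀ {b : X → E}, Integrable b μ → ∀ n, Integrable (fun x => b (T^[h n] x)) μ :=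
    fun hb n => (hT.iterate (h n)).integrable_comp_of_integrable hb
  have hdiff : ∀ {b : X → E}, Integrable b μ → ∀ n,
      Integrable (fun x => ‖b (T^[h n] x) - b x‖) μ := fun hb n => ((hcomp hb n).sub hb).norm
  have key : ∀ ε : ℝ≥0∞, ε ≠ 0 → ∃ g : X → E, eLpNorm (a - g) 1 μ ≤ ε ∧
      (Integrable g μ ∧ Tendsto (fun n => ∫ x, ‖g (T^[h n] x) - g x‖ ∂μ) atTop (𝓝 0)) := by
    intro ε hε
    refine (memLp_one_iff_integrable.2 ha).induction_dense ENNReal.one_ne_top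
      (fun g => Integrable g μ ∧ Tendsto (fun n => ∫ x, ‖g (T^[h n] x) - g x‖ ∂μ) atTop (𝓝 0))
      ?_ ?_ ?_ hε
    · intro c s hs _ ε _
      refine ⟨s.indicator fun _ => c, by simp, (integrable_const c).indicator hs, ?_⟩
      have h1 : ∀ n, ∫ x, ‖s.indicator (fun _ => c) (T^[h n] x) - s.indicator (fun _ => c) x‖ ∂μ
          = μ.real (symmDiff (T^[h n] ⁻¹' s) s) * ‖c‖ := by
        intro n
        have hm : MeasurableSet (symmDiff (T^[h n] ⁻¹' s) s) :=
          ((T.measurable.iterate _) hs).symmDiff hs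
        rw [← smul_eq_mul, ← integral_indicator_const _ hm]
        refine integral_congr_ae (ae_of_all _ fun x => ?_)
        by_cases h1 : T^[h n] x ∈ s <;> by_cases h2 : x ∈ s <;>
          simp [h1, h2, Set.indicator, Set.mem_symmDiff]
      simp only [h1]
      have := (ENNReal.tendsto_toReal ENNReal.zero_ne_top).comp
        (hh.tendsto_measure_preimage hT hs)
      simpa [Measure.real, Function.comp_def] using this.mul_const ‖c‖
    · rintro f g ⟨hf, hf'⟩ ⟨hg, hg'⟩
      refine ⟨hf.add hg, squeeze_zero (fun n => integral_nonneg fun x => norm_nonneg _)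
        (fun n => ?_) (by simpa using hf'.add hg')⟩
      rw [← integral_add (hdiff hf n) (hdiff hg n)]
      refine integral_mono (hdiff (hf.add hg) n) ((hdiff hf n).add (hdiff hg n)) fun x => ?_
      simp only [Pi.add_apply, add_sub_add_comm]
      exact norm_add_le _ _
    · rintro f ⟨hf, -⟩
      exact hf.1
  rw [Metric.tendsto_nhds]
  intro ε hε
  obtain ⟨g, hg, hgi, hg0⟩ := key (ENNReal.ofReal (ε / 4)) (by simpa using hε)
  have hag : ∫ x, ‖a x - g x‖ ∂μ ≤ ε / 4 := by
    change ∫ x, ‖(a - g) x‖ ∂μ ≤ ε / 4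
    rw [integral_norm_eq_lintegral_enorm (ha.sub hgi).1, ← eLpNorm_one_eq_lintegral_enorm]
    exact ENNReal.toReal_le_of_le_ofReal (by positivity) hg
  filter_upwards [Metric.tendsto_nhds.1 hg0 (ε / 4) (by positivity)] with n hn
  rw [dist_zero_right, Real.norm_of_nonneg (integral_nonneg fun x => norm_nonneg _)] at hn ⊢
  have h2 : ∫ x, ‖a (T^[h n] x) - g (T^[h n] x)‖ ∂μ = ∫ x, ‖a x - g x‖ ∂μ := by
    have hm := hT.iterate (h n)
    have := integral_map (f := fun x => ‖a x - g x‖) hm.aemeasurable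
      (by rw [hm.map_eq]; exact (ha.sub hgi).1.norm)
    rw [hm.map_eq] at this
    exact this.symm
  have h3 : ∫ x, ‖a (T^[h n] x) - a x‖ ∂μ ≤ ∫ x, (‖a (T^[h n] x) - g (T^[h n] x)‖
      + ‖g (T^[h n] x) - g x‖ + ‖a x - g x‖) ∂μ := by
    refine integral_mono ((hcomp ha n).sub ha).norm
      ((((hcomp ha n).sub (hcomp hgi n)).norm.add ((hcomp hgi n).sub hgi).norm).add
        (ha.sub hgi).norm) fun x => ?_
    have e : a (T^[h n] x) - a x = (a (T^[h n] x) - g (T^[h n] x))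
      + (g (T^[h n] x) - g x) - (a x - g x) := by abel
    beta_reduce
    rw [e]
    exact (norm_sub_le _ _).trans (add_le_add_left (norm_add_le _ _) _)
  rw [integral_add, integral_add, h2] at h3
  · linarith
  · exact ((hcomp ha n).sub (hcomp hgi n)).norm
  · exact ((hcomp hgi n).sub hgi).norm
  · exact ((hcomp ha n).sub (hcomp hgi n)).norm.add ((hcomp hgi n).sub hgi).norm
  · exact (ha.sub hgi).norm

/-- Applying the hypothesis to the image of `S` under `T` and changing variables shows that `a` and
`a ∘ T` have the same integral over every `S`, so `a` is invariant. -/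
theorem Ergodic.ae_eq_const_of_forall_setIntegral_preimage_eq [IsProbabilityMeasure μ] {T : X ≃ᵐ X}
    (hT : Ergodic T μ) {a : X → ℂ} (ha : Integrable a μ)
    (h : ∀ S, MeasurableSet S → ∫ x in T ⁻¹' S, a x ∂μ = ∫ x in S, a x ∂μ) :
    ∃ z : ℂ, a =ᵐ[μ] Function.const X z := by
  refine hT.quasiErgodic.ae_eq_const_of_ae_eq_comp_ae ha.1 ?_
  refine Integrable.ae_eq_of_forall_setIntegral_eq _ _
    (hT.toMeasurePreserving.integrable_comp_of_integrable ha) ha fun S hS _ => ?_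
  have hS' : MeasurableSet (T.symm ⁻¹' S) := T.symm.measurable hS
  have := h _ hS'
  rw [← Set.preimage_comp] at this
  simp only [MeasurableEquiv.symm_comp_self, Set.preimage_id] at this
  rw [this, ← hT.toMeasurePreserving.setIntegral_preimage_emb T.measurableEmbedding a,
    ← Set.preimage_comp]
  simp

/-- The centred `u n` vanish against constants, and asymptotic invariance kills them against the
coboundaries `1_{T⁻¹S} - 1_S`. This family is total: a function orthogonal to all coboundaries is
invariant, hence constant, and orthogonality to `1` makes it zero. -/
theorem Ergodic.tendsto_integral_mul_sub [IsProbabilityMeasure μ] {T : X ≃ᵐ X}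
    (hT : Ergodic T μ) {u : ℕ → X → ℂ} {B : ℝ} (hu : ∀ n, Measurable (u n))
    (hB : ∀ n x, ‖u n x‖ ≤ B)
    (hinv : Tendsto (fun n => ∫ x, ‖u n (T x) - u n x‖ ∂μ) atTop (𝓝 0))
    {a : X → ℂ} (ha : MemLp a 2 μ) :
    Tendsto (fun n => ∫ x, a x * u n x ∂μ - (∫ x, u n x ∂μ) * ∫ x, a x ∂μ) atTop (𝓝 0) := by
  have hui : ∀ n, Integrable (u n) μ := fun n =>
    Integrable.of_bound (hu n).aestronglyMeasurable B (ae_of_all _ (hB n))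
  have hmean : ∀ n, ‖∫ x, u n x ∂μ‖ ≤ B := fun n => by
    simpa using norm_integral_le_of_norm_le_const (ae_of_all μ (hB n))
  have hTi : ∀ {b : X → ℂ}, Integrable b μ → Integrable (fun x => b (T x)) μ :=
    fun hb => hT.toMeasurePreserving.integrable_comp_of_integrable hb
  have hTint : ∀ b : X → ℂ, ∫ x, b (T x) ∂μ = ∫ x, b x ∂μ := fun b =>
    hT.toMeasurePreserving.integral_comp' b
  have key := tendsto_integral_mul_zero_of_total (ν := μ) (l := atTop) (B := B + B)
    (u := fun n x => u n x - ∫ x, u n x ∂μ)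
    (fun n => ((hu n).sub_const _).aestronglyMeasurable)
    (fun n x => (norm_sub_le _ _).trans (add_le_add (hB n x) (hmean n)))
    (D := {e | e = 1 ∨ ∃ S, MeasurableSet S ∧
      e = (T ⁻¹' S).indicator (1 : X → ℂ) - S.indicator 1}) ?_ ?_ ?_ ha
  · refine key.congr fun n => ?_
    simp only [mul_sub]
    rw [integral_sub, integral_mul_const, mul_comm (∫ x, a x ∂μ)]
    · exact (ha.integrable one_le_two).mul_bdd (hu n).aestronglyMeasurable (ae_of_all _ (hB n))
    · exact (ha.integrable one_le_two).mul_const _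
  · have hind : ∀ {A : Set X}, MeasurableSet A → MemLp (A.indicator (1 : X → ℂ)) 2 μ :=
      fun hA => (memLp_const (1 : ℂ)).indicator hA
    rintro _ (rfl | ⟨S, hS, rfl⟩)
    · simpa using hind MeasurableSet.univ
    · exact (hind (T.measurable hS)).sub (hind hS)
  · rintro _ (rfl | ⟨S, hS, rfl⟩)
    · have : ∀ n, ∫ x, (1 : X → ℂ) x * (u n x - ∫ x, u n x ∂μ) ∂μ = 0 := fun n => by
        simp only [Pi.one_apply, one_mul]
        rw [integral_sub (hui n) (integrable_const _)]
        simp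
      simp only [this, tendsto_const_nhds]
    · refine squeeze_zero_norm (fun n => ?_) hinv
      set m := ∫ x, u n x ∂μ
      have hum : Integrable (fun x => u n x - m) μ := (hui n).sub (integrable_const m)
      have hmul : ∀ {A : Set X} {v : X → ℂ}, MeasurableSet A → Integrable v μ →
          Integrable (fun x => A.indicator (1 : X → ℂ) x * v x) μ := fun hA hv =>
        hv.bdd_mul (c := 1) (measurable_one.indicator hA).aestronglyMeasurable
          (ae_of_all _ fun x => (norm_indicator_le_norm_self _ _).trans (by simp))
      -- Changing variables by `T` in the second term moves the coboundary onto `u n`.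
      have e : ∫ x, ((T ⁻¹' S).indicator 1 - S.indicator 1 : X → ℂ) x * (u n x - m) ∂μ
          = ∫ x, (T ⁻¹' S).indicator (1 : X → ℂ) x * (u n x - u n (T x)) ∂μ := by
        simp only [Pi.sub_apply, sub_mul]
        rw [integral_sub (hmul (T.measurable hS) hum) (hmul hS hum),
          ← hTint fun x => S.indicator (1 : X → ℂ) x * (u n x - m), ← integral_sub]
        · refine integral_congr_ae (ae_of_all _ fun x => ?_)
          by_cases hx : T x ∈ S <;> simp [hx]
        · exact hmul (T.measurable hS) hum
        · exact hTi (hmul hS hum)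
      rw [e]
      refine norm_integral_le_of_norm_le ((hTi (hui n)).sub (hui n)).norm (ae_of_all _ fun x => ?_)
      rw [norm_mul, norm_sub_rev]
      exact mul_le_of_le_one_left (norm_nonneg _)
        ((norm_indicator_le_norm_self _ _).trans (by simp))
  · intro a ha h
    have hai := ha.integrable one_le_two
    obtain ⟨z, hz⟩ := hT.ae_eq_const_of_forall_setIntegral_preimage_eq hai fun S hS => by
      have h1 := h _ (Or.inr ⟨S, hS, rfl⟩)
      rw [← integral_indicator (T.measurable hS), ← integral_indicator hS, ← sub_eq_zero,
        ← integral_sub (hai.indicator (T.measurable hS)) (hai.indicator hS), ← h1]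
      refine integral_congr_ae (ae_of_all _ fun x => ?_)
      by_cases h1 : T x ∈ S <;> by_cases h2 : x ∈ S <;> simp [h1, h2]
    have h1 := h 1 (Or.inl rfl)
    rw [integral_congr_ae (g := fun _ => z) (by filter_upwards [hz] with x hx; simp [hx])] at h1
    have hz0 : z = 0 := by simpa using h1
    rw [hz0] at hz
    exact hz

end Ergodic

/-! ### The special flow -/

namespace SpecialFlow

section Algebra

variable {X : Type*} (T : Equiv.Perm X) (f : X → ℝ)

theorem intBirkhoffSum_add (m n : ℤ) (x : X) :
    intBirkhoffSum T f (m + n) x = intBirkhoffSum T f n x + intBirkhoffSum T f m ((T ^ n) x) := by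
  induction m using Int.induction_on with
  | zero => simp [intBirkhoffSum_zero]
  | succ i ih =>
    rw [add_right_comm, intBirkhoffSum_succ, intBirkhoffSum_succ, ih, zpow_add, Equiv.Perm.mul_apply,
      add_assoc]
  | pred i ih =>
    have h1 := intBirkhoffSum_succ T f (-i - 1 + n) x
    have h2 := intBirkhoffSum_succ T f (-i - 1) ((T ^ n) x)
    rw [zpow_add, Equiv.Perm.mul_apply] at h1
    rw [show -(i : ℤ) - 1 + n + 1 = -i + n by ring, ih] at h1
    rw [show -(i : ℤ) - 1 + 1 = -i by ring] at h2
    linarith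

theorem intBirkhoffSum_natCast (n : ℕ) (x : X) :
    intBirkhoffSum T f n x = birkhoffSum T f n x := by
  induction n with
  | zero => simp [intBirkhoffSum_zero]
  | succ n ih =>
    push_cast
    rw [intBirkhoffSum_succ, birkhoffSum_succ, ih, zpow_natCast, Equiv.Perm.iterate_eq_pow]

/-- Translation by `t` along the fibres of `X × ℝ` followed by `n` jumps. -/
noncomputable def jumpMap (n : ℤ) (t : ℝ) (p : X × ℝ) : X × ℝ :=
  ((T ^ n) p.1, p.2 + t - intBirkhoffSum T f n p.1)

theorem jumpMap_jumpMap (m n : ℤ) (s t : ℝ) (p : X × ℝ) :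
    jumpMap T f m s (jumpMap T f n t p) = jumpMap T f (m + n) (s + t) p := by
  simp only [jumpMap, intBirkhoffSum_add, zpow_add, Equiv.Perm.mul_apply, Prod.mk.injEq, true_and]
  ring

theorem jumpMap_zero (p : X × ℝ) : jumpMap T f 0 0 p = p := by
  simp [jumpMap, intBirkhoffSum_zero]

theorem jumpMap_mem_region_iff (n : ℤ) (t : ℝ) (p : X × ℝ) :
    jumpMap T f n t p ∈ region f ↔ intBirkhoffSum T f n p.1 ≤ p.2 + t ∧
      p.2 + t < intBirkhoffSum T f (n + 1) p.1 := by
  rw [intBirkhoffSum_succ]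
  simp only [jumpMap, region, Set.mem_ofPred_eq, sub_nonneg, sub_lt_iff_lt_add']

theorem flow_eq_jumpMap (t : ℝ) (p : X × ℝ) : flow T f t p = jumpMap T f (jumps T f t p) t p := rfl

/-- Time becomes translation along the fibre, followed by the retraction `flow T f 0` of `X × ℝ`
onto `X^f`. Correlations along the flow thus become correlations of functions on `X × ℝ` under
vertical translation. -/
theorem flow_eq_flow_zero (t : ℝ) (p : X × ℝ) : flow T f t p = flow T f 0 (p.1, p.2 + t) := by
  simp only [flow, jumps, add_zero]

variable {T f} {a : ℝ} (ha : 0 < a) (hf : ∀ x, a ≤ f x)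
include ha hf

theorem existsUnique_jumpMap_mem_region (t : ℝ) (p : X × ℝ) :
    ∃! n : ℤ, jumpMap T f n t p ∈ region f := by
  simpa only [jumpMap_mem_region_iff] using existsUnique_jumps T f ha hf t p

theorem flow_eq_of_jumpMap_mem_region {n : ℤ} {t : ℝ} {p : X × ℝ}
    (h : jumpMap T f n t p ∈ region f) : flow T f t p = jumpMap T f n t p := by
  rw [flow_eq_jumpMap]
  congr 1
  exact (existsUnique_jumpMap_mem_region ha hf t p).unique (flow_mem_region T f ha hf t p) h

/-- Each orbit of the jumps meets `X^f` exactly once and `flow T f 0` picks that point, so it is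
constant on orbits. -/
theorem flow_zero_jumpMap (n : ℤ) (p : X × ℝ) :
    flow T f 0 (jumpMap T f n 0 p) = flow T f 0 p := by
  have h := flow_mem_region T f ha hf 0 (jumpMap T f n 0 p)
  rw [flow_eq_jumpMap, jumpMap_jumpMap, add_zero] at h
  rw [flow_eq_of_jumpMap_mem_region ha hf h, flow_eq_jumpMap _ _ _ (jumpMap _ _ _ _ _),
    jumpMap_jumpMap, add_zero]

theorem flow_zero_iterate (n : ℕ) (x : X) (r : ℝ) :
    flow T f 0 (T^[n] x, r - birkhoffSum T f n x) = flow T f 0 (x, r) := by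
  rw [← flow_zero_jumpMap ha hf n (x, r), ← intBirkhoffSum_natCast, jumpMap]
  simp [Equiv.Perm.iterate_eq_pow]

end Algebra

section Measurable

variable {X : Type*} [MeasurableSpace X] {μ : Measure X} {T : X ≃ᵐ X} {f : X → ℝ}

theorem _root_.MeasurableEquiv.measurable_zpow (T : X ≃ᵐ X) (n : ℤ) :
    Measurable (T.toEquiv ^ n : Equiv.Perm X) := by
  rcases n.eq_nat_or_neg with ⟨k, rfl | rfl⟩
  · rw [zpow_natCast, ← Equiv.Perm.iterate_eq_pow]
    exact T.measurable.iterate k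
  · rw [zpow_neg, zpow_natCast, ← inv_pow, ← Equiv.Perm.iterate_eq_pow]
    exact T.symm.measurable.iterate k

theorem _root_.MeasureTheory.MeasurePreserving.zpow (hT : MeasurePreserving T μ μ) (n : ℤ) :
    MeasurePreserving (T.toEquiv ^ n : Equiv.Perm X) μ μ := by
  rcases n.eq_nat_or_neg with ⟨k, rfl | rfl⟩
  · rw [zpow_natCast, ← Equiv.Perm.iterate_eq_pow]
    exact hT.iterate k
  · rw [zpow_neg, zpow_natCast, ← inv_pow, ← Equiv.Perm.iterate_eq_pow]
    exact (hT.symm T).iterate k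

theorem measurable_intBirkhoffSum (hf : Measurable f) (n : ℤ) :
    Measurable (intBirkhoffSum T.toEquiv f n) := by
  have h : ∀ i : ℤ, Measurable fun x => f ((T.toEquiv ^ i : Equiv.Perm X) x) :=
    fun i => hf.comp (T.measurable_zpow i)
  unfold intBirkhoffSum
  split_ifs
  · exact Finset.measurable_fun_sum _ fun i _ => h i
  · exact (Finset.measurable_fun_sum _ fun i _ => h i).neg

theorem measurable_jumpMap (hf : Measurable f) (n : ℤ) (t : ℝ) :
    Measurable (jumpMap T.toEquiv f n t) := by
  have h1 := T.measurable_zpow n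
  have h2 := measurable_intBirkhoffSum (T := T) hf n
  unfold jumpMap
  exact (h1.comp measurable_fst).prodMk ((measurable_snd.add_const t).sub (h2.comp measurable_fst))

theorem measurableSet_region (hf : Measurable f) : MeasurableSet (region f) :=
  (measurableSet_le measurable_const measurable_snd).inter
    (measurableSet_lt measurable_snd (hf.comp measurable_fst))

theorem measurePreserving_jumpMap [SFinite μ] (hT : MeasurePreserving T μ μ) (hf : Measurable f)
    (n : ℤ) (t : ℝ) :
    MeasurePreserving (jumpMap T.toEquiv f n t) (μ.prod volume) (μ.prod volume) := by
  refine (hT.zpow n).skew_product (g := fun x r => r + t - intBirkhoffSum T.toEquiv f n x) ?_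
    (ae_of_all _ fun x => ?_)
  · exact (measurable_snd.add_const t).sub ((measurable_intBirkhoffSum hf n).comp measurable_fst)
  · simp only [add_sub_assoc]
    exact map_add_right_eq_self volume _

variable {a : ℝ} (ha : 0 < a) (hfa : ∀ x, a ≤ f x)
include ha hfa

theorem measurable_flow (hf : Measurable f) (t : ℝ) : Measurable (flow T.toEquiv f t) := by
  intro B hB
  have : flow T.toEquiv f t ⁻¹' B = ⋃ n : ℤ, jumpMap T.toEquiv f n t ⁻¹' (B ∩ region f) := by
    ext p
    simp only [Set.mem_preimage, Set.mem_iUnion, Set.mem_inter_iff]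
    constructor
    · exact fun h => ⟨_, h, flow_mem_region _ f ha hfa t p⟩
    · rintro ⟨n, h1, h2⟩
      rwa [flow_eq_of_jumpMap_mem_region ha hfa h2]
  rw [this]
  exact MeasurableSet.iUnion fun n => measurable_jumpMap hf n t (hB.inter (measurableSet_region hf))

/-- Cut `X^f` by the number of jumps. On each piece the flow is a jump map, which preserves `μ ×
Lebesgue`; the images tile `X^f` because time `-t` also has a unique number of jumps at each point.
-/
theorem measurePreserving_flow [SFinite μ] (hT : MeasurePreserving T μ μ) (hf : Measurable f)
    (t : ℝ) :
    MeasurePreserving (flow T.toEquiv f t) (regionMeasure μ f) (regionMeasure μ f) := by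
  refine ⟨measurable_flow ha hfa hf t, Measure.ext fun B hB => ?_⟩
  have hreg := measurableSet_region hf
  have hθ := fun n s => measurable_jumpMap (T := T) hf n s
  rw [Measure.map_apply (measurable_flow ha hfa hf t) hB, regionMeasure,
    Measure.restrict_apply (measurable_flow ha hfa hf t hB), Measure.restrict_apply hB]
  have h1 : flow T.toEquiv f t ⁻¹' B ∩ region f
      = ⋃ n : ℤ, region f ∩ jumpMap T.toEquiv f n t ⁻¹' (B ∩ region f) := by
    ext p
    simp only [Set.mem_preimage, Set.mem_iUnion, Set.mem_inter_iff]
    constructor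
    · exact fun h => ⟨_, h.2, h.1, flow_mem_region _ f ha hfa t p⟩
    · rintro ⟨n, h0, h1, h2⟩
      rw [flow_eq_of_jumpMap_mem_region ha hfa h2]
      exact ⟨h1, h0⟩
  have h2 : B ∩ region f
      = ⋃ n : ℤ, jumpMap T.toEquiv f (-n) (-t) ⁻¹' region f ∩ (B ∩ region f) := by
    rw [← Set.iUnion_inter, eq_comm, Set.inter_eq_right]
    intro p _
    obtain ⟨n, hn, -⟩ := existsUnique_jumpMap_mem_region (T := T.toEquiv) ha hfa (-t) p
    exact Set.mem_iUnion.2 ⟨-n, by simpa using hn⟩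
  rw [h1, measure_iUnion]
  · conv_rhs => rw [h2]
    rw [measure_iUnion]
    · refine tsum_congr fun n => ?_
      rw [← (measurePreserving_jumpMap hT hf (-n) (-t)).measure_preimage
        (hreg.inter (hθ n t (hB.inter hreg))).nullMeasurableSet, Set.preimage_inter,
        ← Set.preimage_comp]
      congr 2
      have : jumpMap T.toEquiv f n t ∘ jumpMap T.toEquiv f (-n) (-t) = id := by
        funext p
        simp [jumpMap_jumpMap, jumpMap_zero]
      rw [this, Set.preimage_id]
    · intro m n hmn
      refine Set.disjoint_left.2 fun p hm hn => hmn ?_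
      exact neg_injective ((existsUnique_jumpMap_mem_region (T := T.toEquiv) ha hfa (-t) p).unique
        hm.1 hn.1)
    · exact fun n => (hθ _ _ hreg).inter (hB.inter hreg)
  · intro m n hmn
    refine Set.disjoint_left.2 fun p hm hn => hmn ?_
    exact (existsUnique_jumpMap_mem_region (T := T.toEquiv) ha hfa t p).unique hm.2.2 hn.2.2
  · exact fun n => hreg.inter (hθ _ _ (hB.inter hreg))

end Measurable

end SpecialFlow

/-! ### Asymptotics of the correlations along the rigidity sequence -/

namespace SpecialFlow

/-- The centred Birkhoff sum `S_{h n}(f) - c n`, set to zero off `C n`. -/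
noncomputable def deviation {X : Type*} (T : X → X) (f : X → ℝ) (h : ℕ → ℕ) (C : ℕ → Set X)
    (c : ℕ → ℝ) (n : ℕ) : X → ℝ :=
  (C n).indicator fun x => birkhoffSum T f (h n) x - c n

section

variable {X : Type*} [MeasurableSpace X] {μ : Measure X} [IsProbabilityMeasure μ] {T : X ≃ᵐ X}
  {f : X → ℝ} {h : ℕ → ℕ} {C : ℕ → Set X} {c : ℕ → ℝ}

theorem measurable_birkhoffSum {T : X → X} (hT : Measurable T) (hf : Measurable f) (n : ℕ) :
    Measurable (birkhoffSum T f n) := by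
  unfold birkhoffSum
  exact Finset.measurable_fun_sum _ fun i _ => hf.comp (hT.iterate i)

theorem measurable_deviation (hf : Measurable f) (hC : ∀ n, MeasurableSet (C n)) (n : ℕ) :
    Measurable (deviation T f h C c n) :=
  ((measurable_birkhoffSum T.measurable hf _).sub_const _).indicator (hC n)

theorem tendsto_measureReal_compl_zero (hC_meas : ∀ n, MeasurableSet (C n))
    (hC : Tendsto (fun n => μ (C n)) atTop (𝓝 1)) :
    Tendsto (fun n => μ.real (C n)ᶜ) atTop (𝓝 0) := by
  have h1 := (ENNReal.tendsto_toReal ENNReal.one_ne_top).comp hC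
  have h2 := h1.const_sub 1
  simp only [ENNReal.toReal_one, sub_self] at h2
  exact h2.congr fun n => (probReal_compl_eq_one_sub (hC_meas n)).symm

/-- The centring `c n` cancels and the Birkhoff sums telescope, so on `C n ∩ T⁻¹ (C n)` the
integrand is at most `|f ∘ T^{h n} - f|`. Off this set it is at most `2`, which costs at most `4 μ(C
nᶜ)`. -/
theorem tendsto_integral_deviation_comp_sub (hT : MeasurePreserving T μ μ)
    (hf_int : Integrable f μ) (hh : IsRigiditySequence T μ h) (hC_meas : ∀ n, MeasurableSet (C n))
    (hC : Tendsto (fun n => μ (C n)) atTop (𝓝 1)) {χ : ℝ → ℝ} (hχ : LipschitzWith 1 χ)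
    (hχ1 : ∀ u, |χ u| ≤ 1) :
    Tendsto (fun n => ∫ x, ‖((χ (deviation T f h C c n (T x)) : ℝ) : ℂ)
      - (χ (deviation T f h C c n x) : ℝ)‖ ∂μ) atTop (𝓝 0) := by
  have hC0 := tendsto_measureReal_compl_zero hC_meas hC
  have hlim := (hh.tendsto_integral_norm_sub hT hf_int).add (hC0.const_mul 4)
  rw [mul_zero, add_zero] at hlim
  refine squeeze_zero (fun n => integral_nonneg fun x => norm_nonneg _) (fun n => ?_) hlim
  have hi : Integrable ((C n)ᶜ.indicator fun _ => (2 : ℝ)) μ :=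
    (integrable_const _).indicator (hC_meas n).compl
  have hiT : Integrable (fun x => (C n)ᶜ.indicator (fun _ => (2 : ℝ)) (T x)) μ :=
    hT.integrable_comp_of_integrable hi
  have hii : Integrable (fun x => (C n)ᶜ.indicator (fun _ => (2 : ℝ)) (T x)
      + (C n)ᶜ.indicator (fun _ => (2 : ℝ)) x) μ := hiT.add hi
  have hd : Integrable (fun x => ‖f (T^[h n] x) - f x‖) μ :=
    (((hT.iterate (h n)).integrable_comp_of_integrable hf_int).sub hf_int).norm
  have hval : ∫ x, (C n)ᶜ.indicator (fun _ => (2 : ℝ)) x ∂μ = 2 * μ.real (C n)ᶜ := by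
    rw [integral_indicator_const _ (hC_meas n).compl, smul_eq_mul, mul_comm]
  have hvalT : ∫ x, (C n)ᶜ.indicator (fun _ => (2 : ℝ)) (T x) ∂μ = 2 * μ.real (C n)ᶜ := by
    rw [← hval]
    exact hT.integral_comp' _
  have hsum : ∫ x, (‖f (T^[h n] x) - f x‖ + ((C n)ᶜ.indicator (fun _ => (2 : ℝ)) (T x)
      + (C n)ᶜ.indicator (fun _ => (2 : ℝ)) x)) ∂μ
      = ∫ x, ‖f (T^[h n] x) - f x‖ ∂μ + 4 * μ.real (C n)ᶜ := by
    rw [integral_add hd hii, integral_add hiT hi, hval, hvalT]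
    ring
  rw [← hsum]
  refine integral_mono_of_nonneg (ae_of_all _ fun x => norm_nonneg _) (hd.add hii)
    (ae_of_all _ fun x => ?_)
  have hb : |χ (deviation T f h C c n (T x)) - χ (deviation T f h C c n x)| ≤ 2 := by
    have h1 := abs_le.1 (hχ1 (deviation T f h C c n (T x)))
    have h2 := abs_le.1 (hχ1 (deviation T f h C c n x))
    rw [abs_le]
    constructor <;> linarith
  have h0 : ∀ y, 0 ≤ (C n)ᶜ.indicator (fun _ => (2 : ℝ)) y := fun y =>
    Set.indicator_nonneg (fun _ _ => zero_le_two) y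
  have h0n := norm_nonneg (f (T^[h n] x) - f x)
  beta_reduce
  rw [← Complex.ofReal_sub, Complex.norm_real, Real.norm_eq_abs]
  by_cases hx : x ∈ C n
  · by_cases hTx : T x ∈ C n
    · have h1 := hχ.dist_le_mul (deviation T f h C c n (T x)) (deviation T f h C c n x)
      have h2 : deviation T f h C c n (T x) - deviation T f h C c n x = f (T^[h n] x) - f x := by
        rw [deviation, Set.indicator_of_mem hx, Set.indicator_of_mem hTx, sub_sub_sub_cancel_right,
          birkhoffSum_apply_sub_birkhoffSum]
      rw [Real.dist_eq, Real.dist_eq, h2, NNReal.coe_one, one_mul, ← Real.norm_eq_abs (f _ - _)] at h1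
      linarith [h0 x, h0 (T x)]
    · rw [Set.indicator_of_mem (s := (C n)ᶜ) (a := T x) hTx]
      linarith [h0 x]
  · rw [Set.indicator_of_mem (s := (C n)ᶜ) (a := x) hx]
    linarith [h0 (T x)]

/-- Rigidity replaces `a ∘ T^{h n}` by `a` in `L¹`; asymptotic invariance then decouples `χ(ξ_n)`
from the fixed product `a * b`. -/
theorem tendsto_integral_deviation_mul (hT : Ergodic T μ) (hf : Measurable f)
    (hf_int : Integrable f μ) (hh : IsRigiditySequence T μ h) (hC_meas : ∀ n, MeasurableSet (C n))
    (hC : Tendsto (fun n => μ (C n)) atTop (𝓝 1)) {χ : ℝ → ℝ} (hχ : LipschitzWith 1 χ)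
    (hχ1 : ∀ u, |χ u| ≤ 1) {a b : X → ℂ} (ha : Measurable a) (hb : Measurable b) {A B : ℝ}
    (haA : ∀ x, ‖a x‖ ≤ A) (hbB : ∀ x, ‖b x‖ ≤ B) :
    Tendsto (fun n => ∫ x, (χ (deviation T f h C c n x) : ℂ) * (a (T^[h n] x) * b x) ∂μ
      - (∫ x, (χ (deviation T f h C c n x) : ℂ) ∂μ) * ∫ x, a x * b x ∂μ) atTop (𝓝 0) := by
  have hu : ∀ n, Measurable fun x => (χ (deviation T f h C c n x) : ℂ) := fun n =>
    Complex.measurable_ofReal.comp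
      (hχ.continuous.measurable.comp (measurable_deviation hf hC_meas n))
  have hu1 : ∀ n x, ‖(χ (deviation T f h C c n x) : ℂ)‖ ≤ 1 := fun n x => by
    rw [Complex.norm_real]
    exact hχ1 _
  have hab : ∀ x y, ‖a x * b y‖ ≤ A * B := fun x y => by
    rw [norm_mul]
    exact mul_le_mul (haA x) (hbB y) (norm_nonneg _) ((norm_nonneg _).trans (haA x))
  have hai : Integrable a μ := Integrable.of_bound ha.aestronglyMeasurable A (ae_of_all _ haA)
  have hTn : ∀ n, Measurable fun x => a (T^[h n] x) := fun n =>
    ha.comp (T.measurable.iterate (h n))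
  have h1 := hT.tendsto_integral_mul_sub hu hu1
    (tendsto_integral_deviation_comp_sub hT.toMeasurePreserving hf_int hh hC_meas hC hχ hχ1)
    (MemLp.of_bound (ha.mul hb).aestronglyMeasurable (A * B) (ae_of_all _ fun x => hab x x))
  have h2 : Tendsto (fun n => ∫ x, (χ (deviation T f h C c n x) : ℂ)
      * ((a (T^[h n] x) - a x) * b x) ∂μ) atTop (𝓝 0) := by
    have := (hh.tendsto_integral_norm_sub hT.toMeasurePreserving hai).mul_const B
    rw [zero_mul] at this
    refine squeeze_zero_norm (fun n => ?_) this
    rw [← integral_mul_const]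
    refine norm_integral_le_of_norm_le ?_ (ae_of_all _ fun x => ?_)
    · exact ((((hT.toMeasurePreserving.iterate (h n)).integrable_comp_of_integrable hai).sub
        hai).norm).mul_const B
    · rw [norm_mul, norm_mul]
      exact (mul_le_of_le_one_left (by positivity) (hu1 n x)).trans
        (mul_le_mul_of_nonneg_left (hbB x) (norm_nonneg _))
  have h3 := h2.add h1
  rw [add_zero] at h3
  refine h3.congr fun n => ?_
  rw [← add_sub_assoc, ← integral_add]
  · congr 1
    refine integral_congr_ae (ae_of_all _ fun x => ?_)
    simp only [Pi.mul_apply]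
    ring
  · refine Integrable.of_bound (((hu n).mul (((hTn n).sub ha).mul hb)).aestronglyMeasurable)
      (A * B + A * B) (ae_of_all _ fun x => ?_)
    rw [norm_mul, sub_mul]
    refine (mul_le_of_le_one_left (norm_nonneg _) (hu1 n x)).trans ((norm_sub_le _ _).trans ?_)
    exact add_le_add (hab _ _) (hab _ _)
  · refine Integrable.of_bound (((ha.mul hb).mul (hu n)).aestronglyMeasurable)
      (A * B) (ae_of_all _ fun x => ?_)
    rw [norm_mul]
    exact (mul_le_of_le_one_right (norm_nonneg _) (hu1 n x)).trans (hab x x)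

/-- The base statement at each height `r`, integrated by dominated convergence over the finite
measure `ν`. -/
theorem tendsto_integral_prod_deviation_mul (hT : Ergodic T μ) (hf : Measurable f)
    (hf_int : Integrable f μ) (hh : IsRigiditySequence T μ h) (hC_meas : ∀ n, MeasurableSet (C n))
    (hC : Tendsto (fun n => μ (C n)) atTop (𝓝 1)) {χ : ℝ → ℝ} (hχ : LipschitzWith 1 χ)
    (hχ1 : ∀ u, |χ u| ≤ 1) (ν : Measure ℝ) [IsFiniteMeasure ν] {a b : X × ℝ → ℂ} (ha : Measurable a)
    (hb : Measurable b) {A B : ℝ} (haA : ∀ x, ‖a x‖ ≤ A) (hbB : ∀ x, ‖b x‖ ≤ B) :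
    Tendsto (fun n => ∫ y, (χ (deviation T f h C c n y.1) : ℂ) * (a (T^[h n] y.1, y.2) * b y)
      ∂(μ.prod ν) - (∫ x, (χ (deviation T f h C c n x) : ℂ) ∂μ) * ∫ y, a y * b y ∂(μ.prod ν))
      atTop (𝓝 0) := by
  have hu : ∀ n, Measurable fun x => (χ (deviation T f h C c n x) : ℂ) := fun n =>
    Complex.measurable_ofReal.comp
      (hχ.continuous.measurable.comp (measurable_deviation hf hC_meas n))
  have hu1 : ∀ n x, ‖(χ (deviation T f h C c n x) : ℂ)‖ ≤ 1 := fun n x => by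
    rw [Complex.norm_real]
    exact hχ1 _
  have hab : ∀ x y, ‖a x * b y‖ ≤ A * B := fun x y => by
    rw [norm_mul]
    exact mul_le_mul (haA x) (hbB y) (norm_nonneg _) ((norm_nonneg _).trans (haA x))
  have hbd : ∀ n (y z : X × ℝ) (x : X), ‖(χ (deviation T f h C c n x) : ℂ) * (a y * b z)‖ ≤ A * B :=
    fun n y z x => by
      rw [norm_mul]
      exact (mul_le_of_le_one_left (norm_nonneg _) (hu1 n x)).trans (hab y z)
  have hTn : ∀ n, Measurable fun y : X × ℝ => a (T^[h n] y.1, y.2) := fun n =>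
    ha.comp (((T.measurable.iterate (h n)).comp measurable_fst).prodMk measurable_snd)
  have hi1 : ∀ n, Integrable (fun y : X × ℝ => (χ (deviation T f h C c n y.1) : ℂ)
      * (a (T^[h n] y.1, y.2) * b y)) (μ.prod ν) := fun n =>
    Integrable.of_bound ((((hu n).comp measurable_fst).mul ((hTn n).mul hb)).aestronglyMeasurable)
      (A * B) (ae_of_all _ fun y => hbd n _ _ _)
  have hi2 : Integrable (fun y => a y * b y) (μ.prod ν) :=
    Integrable.of_bound (ha.mul hb).aestronglyMeasurable (A * B) (ae_of_all _ fun y => hab y y)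
  have hmean : ∀ n, ‖∫ x, (χ (deviation T f h C c n x) : ℂ) ∂μ‖ ≤ 1 := fun n => by
    simpa using norm_integral_le_of_norm_le_const (ae_of_all μ (hu1 n))
  have key := tendsto_integral_of_dominated_convergence (μ := ν)
    (F := fun n r => ∫ x, (χ (deviation T f h C c n x) : ℂ) * (a (T^[h n] x, r) * b (x, r)) ∂μ
      - (∫ x, (χ (deviation T f h C c n x) : ℂ) ∂μ) * ∫ x, a (x, r) * b (x, r) ∂μ)
    (f := fun _ => 0) (fun _ => A * B + A * B) (fun n => ?_) (integrable_const _)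
    (fun n => ae_of_all _ fun r => ?_) (ae_of_all _ fun r => ?_)
  · rw [integral_zero] at key
    refine key.congr fun n => ?_
    rw [integral_prod_symm _ (hi1 n), integral_prod_symm _ hi2,
      integral_sub (hi1 n).integral_prod_right (hi2.integral_prod_right.const_mul _),
      integral_const_mul]
  · exact (hi1 n).integral_prod_right.1.sub (hi2.integral_prod_right.1.const_mul _)
  · refine (norm_sub_le _ _).trans (add_le_add ?_ ?_)
    · simpa using norm_integral_le_of_norm_le_const (ae_of_all μ fun x => hbd n _ _ x)
    · rw [norm_mul]
      refine (mul_le_of_le_one_left (norm_nonneg _) (hmean n)).trans ?_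
      simpa using norm_integral_le_of_norm_le_const (ae_of_all μ fun x => hab (x, r) (x, r))
  · have har : Measurable fun x => a (x, r) := ha.comp measurable_prodMk_right
    have hbr : Measurable fun x => b (x, r) := hb.comp measurable_prodMk_right
    have haAr : ∀ x, ‖a (x, r)‖ ≤ A := fun x => haA _
    have hbBr : ∀ x, ‖b (x, r)‖ ≤ B := fun x => hbB _
    have key := tendsto_integral_deviation_mul (c := c) hT hf hf_int hh hC_meas hC hχ hχ1 har hbr
      haAr hbBr
    exact key

end

end SpecialFlow

/-! ### The smoothing kernel and its averages over the deviations -/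

namespace SpecialFlow

/-- The kernel `s ↦ e^{-|s - t|}`. -/
noncomputable def expKernel (t s : ℝ) : ℝ := Real.exp (-|s - t|)

theorem continuous_expKernel (t : ℝ) : Continuous (expKernel t) := by
  unfold expKernel
  fun_prop

theorem expKernel_pos (t s : ℝ) : 0 < expKernel t s := Real.exp_pos _

theorem expKernel_le_one (t s : ℝ) : expKernel t s ≤ 1 := by
  unfold expKernel
  simp

theorem abs_expKernel_le_one (t s : ℝ) : |expKernel t s| ≤ 1 := by
  rw [abs_of_pos (expKernel_pos t s)]
  exact expKernel_le_one t s

theorem lipschitzWith_exp_neg_abs : LipschitzWith 1 fun s : ℝ => Real.exp (-|s|) := by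
  refine LipschitzWith.of_le_add_mul 1 fun x y => ?_
  have h1 := Real.add_one_le_exp (|x| - |y|)
  have h2 : |y| - |x| ≤ dist x y := by
    rw [Real.dist_eq, abs_sub_comm]
    exact abs_sub_abs_le_abs_sub y x
  have h3 : Real.exp (-|x|) ≤ 1 := by simp
  have h4 : Real.exp (-|y|) = Real.exp (-|x|) * Real.exp (|x| - |y|) := by
    rw [← Real.exp_add]
    ring_nf
  have h5 := Real.exp_pos (-|x|)
  rw [h4, NNReal.coe_one, one_mul]
  nlinarith [dist_nonneg (x := x) (y := y)]

theorem lipschitzWith_expKernel_add (t w : ℝ) : LipschitzWith 1 fun u => expKernel t (w + u) := by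
  have h : LipschitzWith 1 fun u : ℝ => w + u - t := by
    refine LipschitzWith.of_dist_le_mul fun x y => ?_
    simp
  simpa [Function.comp_def, expKernel] using lipschitzWith_exp_neg_abs.comp h

theorem integrable_exp_neg_mul_abs {b : ℝ} (hb : 0 < b) :
    Integrable fun s : ℝ => Real.exp (-b * |s|) := by
  rw [← integrableOn_univ, ← Set.Iic_union_Ioi (a := (0 : ℝ)), integrableOn_union]
  constructor
  · refine (integrableOn_exp_mul_Iic hb 0).congr_fun (fun s hs => ?_) measurableSet_Iic
    rw [abs_of_nonpos hs]
    ring_nf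
  · refine (integrableOn_exp_mul_Ioi (neg_lt_zero.2 hb) 0).congr_fun (fun s hs => ?_)
      measurableSet_Ioi
    rw [abs_of_pos hs]

theorem integrable_expKernel (t : ℝ) : Integrable (expKernel t) := by
  have := (integrable_exp_neg_mul_abs one_pos).comp_sub_right t
  unfold expKernel
  simpa using this

section

variable {X : Type*} [MeasurableSpace X] {μ : Measure X}

/-- The convolution of the kernel with the reflected distribution of the deviation. -/
noncomputable def averagedKernel (μ : Measure X) (t : ℝ) (ξ : X → ℝ) (w : ℝ) : ℝ :=
  ∫ x, expKernel t (w + ξ x) ∂μ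

theorem averagedKernel_nonneg (t : ℝ) (ξ : X → ℝ) (w : ℝ) : 0 ≤ averagedKernel μ t ξ w :=
  integral_nonneg fun _ => (expKernel_pos _ _).le

theorem averagedKernel_ofReal (t : ℝ) (ξ : X → ℝ) (w : ℝ) :
    (averagedKernel μ t ξ w : ℂ) = ∫ x, (expKernel t (w + ξ x) : ℂ) ∂μ :=
  integral_complex_ofReal.symm

variable [IsProbabilityMeasure μ] {T : X ≃ᵐ X} {f : X → ℝ} {h : ℕ → ℕ} {C : ℕ → Set X} {c : ℕ → ℝ}

theorem measurable_averagedKernel (t : ℝ) {ξ : X → ℝ} (hξ : Measurable ξ) :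
    Measurable (averagedKernel μ t ξ) := by
  refine (StronglyMeasurable.integral_prod_right' (ν := μ)
    (f := fun p : ℝ × X => expKernel t (p.1 + ξ p.2)) ?_).measurable
  have := (continuous_expKernel t).measurable
  exact Measurable.stronglyMeasurable (by fun_prop)

/-- The majorant of the averaged kernels. -/
noncomputable def kernelBound (t K b w : ℝ) : ℝ :=
  Real.exp |t| * Real.exp (-(1 / 2) * |w|) + K * Real.exp (-(b / 2) * |w|)

theorem integrable_kernelBound (t K : ℝ) {b : ℝ} (hb : 0 < b) : Integrable (kernelBound t K b) :=
  ((integrable_exp_neg_mul_abs one_half_pos).const_mul _).add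
    ((integrable_exp_neg_mul_abs (half_pos hb)).const_mul _)

/-- Split at `|ξ_n| = |w| / 2`: below it, `|w + ξ_n - t| ≥ |w| / 2 - |t|`; above it the kernel is at
most `1` and the tail bound applies. The resulting majorant does not depend on `n`, which is what
dominated convergence in `w` requires. -/
theorem averagedKernel_le (hf : Measurable f) (hC : ∀ n, MeasurableSet (C n)) {K b : ℝ} {n : ℕ}
    (htail : ∀ s, 0 ≤ s →
      μ.real {x ∈ C n | s ≤ |birkhoffSum T f (h n) x - c n|} ≤ K * Real.exp (-b * s)) (t w : ℝ) :
    averagedKernel μ t (deviation T f h C c n) w ≤ kernelBound t K b w := by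
  set E : Set X := {x ∈ C n | |w| / 2 ≤ |birkhoffSum T f (h n) x - c n|} with hE
  have hE_meas : MeasurableSet E := (hC n).inter (measurableSet_le measurable_const
    ((measurable_birkhoffSum T.measurable hf _).sub_const _).abs)
  have h1 : ∀ x, expKernel t (w + deviation T f h C c n x)
      ≤ Real.exp |t| * Real.exp (-(1 / 2) * |w|) + E.indicator (fun _ => (1 : ℝ)) x := by
    intro x
    by_cases hx : x ∈ E
    · rw [Set.indicator_of_mem hx]
      have := expKernel_le_one t (w + deviation T f h C c n x)
      have : 0 < Real.exp |t| * Real.exp (-(1 / 2) * |w|) := by positivity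
      linarith
    · rw [Set.indicator_of_notMem hx, add_zero, expKernel, ← Real.exp_add, Real.exp_le_exp]
      have hd : |deviation T f h C c n x| ≤ |w| / 2 := by
        by_cases hxC : x ∈ C n
        · rw [deviation, Set.indicator_of_mem hxC]
          by_contra! hlt
          exact hx ⟨hxC, hlt.le⟩
        · rw [deviation, Set.indicator_of_notMem hxC, abs_zero]
          positivity
      have h2 : |w| ≤ |w + deviation T f h C c n x - t| + |t| + |deviation T f h C c n x| := by
        have e : w = (w + deviation T f h C c n x - t) + t - deviation T f h C c n x := by ring
        calc |w| = |(w + deviation T f h C c n x - t) + t - deviation T f h C c n x| := by rw [← e]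
          _ ≤ |(w + deviation T f h C c n x - t) + t| + |deviation T f h C c n x| := abs_sub _ _
          _ ≤ _ := by gcongr; exact abs_add_le _ _
      linarith
  have hi : Integrable (E.indicator fun _ => (1 : ℝ)) μ := (integrable_const _).indicator hE_meas
  calc averagedKernel μ t (deviation T f h C c n) w
      ≤ ∫ x, (Real.exp |t| * Real.exp (-(1 / 2) * |w|) + E.indicator (fun _ => (1 : ℝ)) x) ∂μ :=
        integral_mono_of_nonneg (ae_of_all _ fun x => (expKernel_pos _ _).le)
          ((integrable_const _).add hi) (ae_of_all _ h1)
    _ = Real.exp |t| * Real.exp (-(1 / 2) * |w|) + μ.real E := by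
        rw [integral_add (integrable_const _) hi, integral_indicator_const _ hE_meas]
        simp
    _ ≤ kernelBound t K b w := by
        refine add_le_add_right ((htail (|w| / 2) (by positivity)).trans_eq ?_) _
        ring_nf

theorem integrable_averagedKernel (hf : Measurable f) (hC : ∀ n, MeasurableSet (C n)) {K b : ℝ}
    (hb : 0 < b) {n : ℕ} (htail : ∀ s, 0 ≤ s →
      μ.real {x ∈ C n | s ≤ |birkhoffSum T f (h n) x - c n|} ≤ K * Real.exp (-b * s)) (t : ℝ) :
    Integrable (averagedKernel μ t (deviation T f h C c n)) :=
  (integrable_kernelBound t K hb).mono'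
    (measurable_averagedKernel t (measurable_deviation hf hC n)).aestronglyMeasurable
    (ae_of_all _ fun w => by
      rw [Real.norm_of_nonneg (averagedKernel_nonneg _ _ _)]
      exact averagedKernel_le hf hC htail t w)

/-- The difference between the smoothed correlation at time `c n` and its average over the
deviations. -/
noncomputable def correlationDefect (μ : Measure X) (t : ℝ) (φ : ℝ → ℂ) (c : ℝ) (ξ : X → ℝ) : ℂ :=
  (∫ s, expKernel t s * φ (c + s)) - ∫ w, averagedKernel μ t ξ w * φ w

end

end SpecialFlow

/-! ### Vanishing of the defect for bounded functions -/

namespace SpecialFlow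

section

variable {X : Type*} [MeasurableSpace X] {μ : Measure X} [IsProbabilityMeasure μ] {T : X ≃ᵐ X}
  {f : X → ℝ} {h : ℕ → ℕ} {C : ℕ → Set X} {c : ℕ → ℝ}

theorem integrable_expKernel_mul {Y : Type*} [MeasurableSpace Y] (m : Measure Y)
    [IsFiniteMeasure m] (t : ℝ) {ξ : Y → ℝ} (hξ : Measurable ξ) {F : Y × ℝ → ℂ} (hF : Measurable F)
    {M : ℝ} (hFM : ∀ p, ‖F p‖ ≤ M) :
    Integrable (fun p : Y × ℝ => (expKernel t (p.2 + ξ p.1) : ℂ) * F p) (m.prod volume) := by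
  have hk := (continuous_expKernel t).measurable
  have hmeas : Measurable fun p : Y × ℝ => expKernel t (p.2 + ξ p.1) := by fun_prop
  have hint : Integrable (fun p : Y × ℝ => expKernel t (p.2 + ξ p.1)) (m.prod volume) := by
    rw [integrable_prod_iff hmeas.aestronglyMeasurable]
    refine ⟨ae_of_all _ fun y => (integrable_expKernel t).comp_add_right (ξ y), ?_⟩
    have : ∀ y, ∫ s, ‖expKernel t (s + ξ y)‖ = ∫ s, ‖expKernel t s‖ := fun y =>
      integral_add_right_eq_self (fun s => ‖expKernel t s‖) (ξ y)
    simp only [this, integrable_const]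
  exact hint.ofReal.mul_bdd hF.aestronglyMeasurable (ae_of_all _ hFM)

theorem norm_integral_expKernel_mul_le (t u : ℝ) {F : ℝ → ℂ} {M : ℝ} (hF : ∀ s, ‖F s‖ ≤ M) :
    ‖∫ s, (expKernel t (s + u) : ℂ) * F s‖ ≤ M * ∫ s, expKernel t s := by
  rw [mul_comm, ← integral_mul_const, ← integral_add_right_eq_self (fun s => expKernel t s * M) u]
  refine norm_integral_le_of_norm_le
    (((integrable_expKernel t).comp_add_right u).mul_const M) (ae_of_all _ fun s => ?_)
  rw [norm_mul, Complex.norm_of_nonneg (expKernel_pos _ _).le]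
  exact mul_le_mul_of_nonneg_left (hF s) (expKernel_pos _ _).le

/-- The correlations of two bounded functions on `X × ℝ`, the first one invariant under the jumps,
under translation along the fibres. -/
theorem tendsto_correlationDefect_of_bounded (hT : Ergodic T μ) (hf : Measurable f)
    (hf_int : Integrable f μ) (hh : IsRigiditySequence T μ h) (hC_meas : ∀ n, MeasurableSet (C n))
    (hC : Tendsto (fun n => μ (C n)) atTop (𝓝 1)) {K b : ℝ} (hb : 0 < b)
    (htail : ∀ n s, 0 ≤ s →
      μ.real {x ∈ C n | s ≤ |birkhoffSum T f (h n) x - c n|} ≤ K * Real.exp (-b * s))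
    (ν : Measure ℝ) [IsFiniteMeasure ν] {G k : X × ℝ → ℂ} (hG : Measurable G) (hk : Measurable k)
    {M N : ℝ} (hGM : ∀ p, ‖G p‖ ≤ M) (hkN : ∀ p, ‖k p‖ ≤ N)
    (hGinv : ∀ (n : ℕ) x r, G (T^[n] x, r - birkhoffSum T f n x) = G (x, r)) (t : ℝ) :
    Tendsto (fun n => correlationDefect μ t
      (fun s => ∫ p, G (p.1, p.2 + s) * k p ∂(μ.prod ν)) (c n) (deviation T f h C c n))
      atTop (𝓝 0) := by
  set m := μ.prod ν with hm
  set ξ := deviation T f h C c with hξ_def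
  set I := ∫ s, expKernel t s
  have hξ : ∀ n, Measurable (ξ n) := fun n => measurable_deviation hf hC_meas n
  have hTn : ∀ n, Measurable (T^[h n]) := fun n => T.measurable.iterate _
  have hbd : ∀ p q, ‖G p * k q‖ ≤ M * N := fun p q => by
    rw [norm_mul]
    exact mul_le_mul (hGM p) (hkN q) (norm_nonneg _) ((norm_nonneg _).trans (hGM p))
  -- the two double integrals over `X × ℝ` and time
  set J₁ : ℕ → X × ℝ → ℂ := fun n p =>
    ∫ s, (expKernel t (s + 0) : ℂ) * (G (p.1, p.2 + (c n + s)) * k p) with hJ₁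
  set J₂ : ℕ → X × ℝ → ℂ := fun n p =>
    ∫ w, (expKernel t (w + ξ n p.1) : ℂ) * (G (T^[h n] p.1, p.2 + w) * k p) with hJ₂
  have hi₁ : ∀ n, Integrable (fun q : (X × ℝ) × ℝ =>
      (expKernel t (q.2 + 0) : ℂ) * (G (q.1.1, q.1.2 + (c n + q.2)) * k q.1)) (m.prod volume) :=
    fun n => integrable_expKernel_mul m t (ξ := fun _ => 0) measurable_const (by fun_prop)
      fun q => hbd _ _
  have hi₂ : ∀ n, Integrable (fun q : (X × ℝ) × ℝ =>
      (expKernel t (q.2 + ξ n q.1.1) : ℂ) * (G (T^[h n] q.1.1, q.1.2 + q.2) * k q.1))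
        (m.prod volume) := fun n => by
    have := hTn n
    exact integrable_expKernel_mul m t (ξ := fun p => ξ n p.1) ((hξ n).comp measurable_fst)
      (F := fun q => G (T^[h n] q.1.1, q.1.2 + q.2) * k q.1) (by fun_prop) fun q => hbd _ _
  have hJi₁ : ∀ n, Integrable (J₁ n) m := fun n => (hi₁ n).integral_prod_left
  have hJi₂ : ∀ n, Integrable (J₂ n) m := fun n => (hi₂ n).integral_prod_left
  have hswap₁ : ∀ n, ∫ s, expKernel t s * ∫ p, G (p.1, p.2 + (c n + s)) * k p ∂m
      = ∫ p, J₁ n p ∂m := fun n => by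
    rw [hJ₁, integral_integral_swap (hi₁ n)]
    simp only [add_zero, integral_const_mul]
  have hswap₂ : ∀ n, ∫ w, ∫ p, (expKernel t (w + ξ n p.1) : ℂ) *
      (G (T^[h n] p.1, p.2 + w) * k p) ∂m = ∫ p, J₂ n p ∂m := fun n => by
    rw [hJ₂, ← integral_integral_swap (hi₂ n)]
  -- they agree over `C n`
  have hJeq : ∀ n p, p.1 ∈ C n → J₁ n p = J₂ n p := fun n p hp => by
    simp only [hJ₁, hJ₂, add_zero]
    rw [← integral_add_right_eq_self (fun s => (expKernel t s : ℂ) *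
      (G (p.1, p.2 + (c n + s)) * k p)) (ξ n p.1)]
    refine integral_congr_ae (ae_of_all _ fun s => ?_)
    beta_reduce
    -- Applying `h n` jumps subtracts `S_{h n}(f) = c n + ξ n` over `C n`, which cancels both the
    -- time `c n` and the shift of `s` by `ξ n`.
    rw [← hGinv (h n) p.1 (p.2 + (c n + (s + ξ n p.1))), hξ_def, deviation,
      Set.indicator_of_mem hp]
    congr 4
    ring
  have hdiff : Tendsto (fun n => ∫ p, J₁ n p ∂m - ∫ p, J₂ n p ∂m) atTop (𝓝 0) := by
    have hlim := (tendsto_measureReal_compl_zero hC_meas hC).const_mul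
      ((M * N * I + M * N * I) * ν.real Set.univ)
    rw [mul_zero] at hlim
    refine squeeze_zero_norm (fun n => ?_) hlim
    have hS : MeasurableSet ((C n)ᶜ ×ˢ (Set.univ : Set ℝ)) := (hC_meas n).compl.prod MeasurableSet.univ
    have h1 : ∀ p, J₁ n p - J₂ n p
        = ((C n)ᶜ ×ˢ (Set.univ : Set ℝ)).indicator (fun p => J₁ n p - J₂ n p) p := fun p => by
      by_cases hp : p.1 ∈ C n
      · rw [Set.indicator_of_notMem (by simp [hp]), hJeq n p hp, sub_self]
      · rw [Set.indicator_of_mem (by simp [hp])]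
    rw [← integral_sub (hJi₁ n) (hJi₂ n), integral_congr_ae (ae_of_all _ h1), integral_indicator hS]
    refine (norm_setIntegral_le_of_norm_le_const (by finiteness) fun p _ =>
      (norm_sub_le _ _).trans (add_le_add
        (norm_integral_expKernel_mul_le t _ fun s => hbd _ _)
        (norm_integral_expKernel_mul_le t _ fun s => hbd _ _))).trans_eq ?_
    rw [hm, measureReal_prod_prod]
    ring
  -- the second one is asymptotically a convolution
  have hMN : 0 ≤ M * N := by
    obtain ⟨x⟩ := nonempty_of_isProbabilityMeasure μ
    exact (norm_nonneg _).trans (hbd (x, 0) (x, 0))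
  have hmass : ∀ w, ‖∫ p, G (p.1, p.2 + w) * k p ∂m‖ ≤ M * N * ν.real Set.univ := fun w => by
    refine (norm_integral_le_of_norm_le_const (ae_of_all _ fun p => hbd _ _)).trans_eq ?_
    rw [hm, ← Set.univ_prod_univ, measureReal_prod_prod, probReal_univ, one_mul]
  have hcorr : Measurable fun w => ∫ p, G (p.1, p.2 + w) * k p ∂m := by
    refine (StronglyMeasurable.integral_prod_right' (ν := m)
      (f := fun q : ℝ × (X × ℝ) => G (q.2.1, q.2.2 + q.1) * k q.2) ?_).measurable
    exact Measurable.stronglyMeasurable (by fun_prop)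
  have hΦ : ∀ n, Integrable fun w =>
      (averagedKernel μ t (ξ n) w : ℂ) * ∫ p, G (p.1, p.2 + w) * k p ∂m := fun n =>
    (integrable_averagedKernel hf hC_meas hb (htail n) t).ofReal.mul_bdd
      hcorr.aestronglyMeasurable (ae_of_all _ hmass)
  have hi₂' := fun n => (hi₂ n).integral_prod_right
  have hconv : Tendsto (fun n => ∫ w, (∫ p, (expKernel t (w + ξ n p.1) : ℂ) *
      (G (T^[h n] p.1, p.2 + w) * k p) ∂m
      - averagedKernel μ t (ξ n) w * ∫ p, G (p.1, p.2 + w) * k p ∂m)) atTop (𝓝 0) := by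
    have hbound := ((integrable_kernelBound t K hb).const_mul (M * N * ν.real Set.univ)).add
      ((integrable_kernelBound t K hb).const_mul (M * N * ν.real Set.univ))
    rw [← integral_zero ℝ ℂ]
    refine tendsto_integral_of_dominated_convergence _ (fun n => ((hi₂' n).sub (hΦ n)).1) hbound
      (fun n => ae_of_all _ fun w => ?_) (ae_of_all _ fun w => ?_)
    · have hle := mul_le_mul_of_nonneg_left
        (averagedKernel_le hf hC_meas (htail n) t w) (mul_nonneg hMN (measureReal_nonneg (μ := ν) (s := Set.univ)))
      refine (norm_sub_le _ _).trans (add_le_add (le_trans ?_ hle) (le_trans ?_ hle))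
      · have hval : ∫ p : X × ℝ, expKernel t (w + ξ n p.1) * (M * N) ∂m
            = M * N * ν.real Set.univ * averagedKernel μ t (ξ n) w := by
          rw [integral_mul_const, hm, integral_fun_fst fun x => expKernel t (w + ξ n x),
            averagedKernel, smul_eq_mul]
          ring
        rw [← hval]
        have hKm := (continuous_expKernel t).measurable
        refine norm_integral_le_of_norm_le (Integrable.mul_const (Integrable.of_bound
          (Measurable.aestronglyMeasurable (by fun_prop)) 1
          (ae_of_all _ fun p => abs_expKernel_le_one t _)) _) (ae_of_all _ fun p => ?_)
        rw [norm_mul, Complex.norm_of_nonneg (expKernel_pos _ _).le]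
        exact mul_le_mul_of_nonneg_left (hbd _ _) (expKernel_pos _ _).le
      · rw [norm_mul, Complex.norm_of_nonneg (averagedKernel_nonneg _ _ _), mul_comm]
        exact mul_le_mul_of_nonneg_right (hmass w) (averagedKernel_nonneg _ _ _)
    -- For fixed `w` the kernel is a bounded `1`-Lipschitz function of the deviation alone; this is
    -- what the smoothing was introduced for.
    · have := tendsto_integral_prod_deviation_mul (c := c) hT hf hf_int hh hC_meas hC
        (lipschitzWith_expKernel_add t w) (fun u => abs_expKernel_le_one t _) ν
        (a := fun p => G (p.1, p.2 + w)) (by fun_prop) hk (fun p => hGM _) hkN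
      simpa only [averagedKernel_ofReal] using this
  have hsum := hdiff.add hconv
  rw [add_zero] at hsum
  refine hsum.congr fun n => ?_
  rw [integral_sub (hi₂' n) (hΦ n), hswap₂, correlationDefect, hswap₁, sub_add_sub_cancel]

end

end SpecialFlow

/-! ### Vanishing of the defect for square-integrable functions -/

namespace SpecialFlow

section

variable {X : Type*} [MeasurableSpace X] {μ : Measure X} [IsProbabilityMeasure μ] {T : X ≃ᵐ X}
  {f : X → ℝ} {h : ℕ → ℕ} {C : ℕ → Set X} {c : ℕ → ℝ}

/-- The defect is linear in `φ`, and both of its kernels have mass bounded independently of `n`. Its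
continuity in the sup norm, uniform in `n`, allows `g` to be approximated. -/
theorem norm_correlationDefect_sub_le (hf : Measurable f) (hC : ∀ n, MeasurableSet (C n)) {K b : ℝ}
    (hb : 0 < b) {n : ℕ} (htail : ∀ s, 0 ≤ s →
      μ.real {x ∈ C n | s ≤ |birkhoffSum T f (h n) x - c n|} ≤ K * Real.exp (-b * s)) (t : ℝ)
    {φ φ' : ℝ → ℂ} (hφ : Measurable φ) (hφ' : Measurable φ') {M M' ε : ℝ} (hM : ∀ s, ‖φ s‖ ≤ M)
    (hM' : ∀ s, ‖φ' s‖ ≤ M') (hε : ∀ s, ‖φ s - φ' s‖ ≤ ε) :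
    ‖correlationDefect μ t φ (c n) (deviation T f h C c n)
      - correlationDefect μ t φ' (c n) (deviation T f h C c n)‖
      ≤ ((∫ s, expKernel t s) + ∫ w, kernelBound t K b w) * ε := by
  have hk : Integrable fun s => (expKernel t s : ℂ) := (integrable_expKernel t).ofReal
  have ha : Integrable fun w => (averagedKernel μ t (deviation T f h C c n) w : ℂ) :=
    (integrable_averagedKernel hf hC hb htail t).ofReal
  have hε0 : 0 ≤ ε := (norm_nonneg _).trans (hε 0)
  have hshift : ∀ {θ : ℝ → ℂ}, Measurable θ → Measurable fun s => θ (c n + s) := fun hθ => by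
    fun_prop
  have e : correlationDefect μ t φ (c n) (deviation T f h C c n)
      - correlationDefect μ t φ' (c n) (deviation T f h C c n)
      = (∫ s, (expKernel t s : ℂ) * (φ (c n + s) - φ' (c n + s)))
        - ∫ w, (averagedKernel μ t (deviation T f h C c n) w : ℂ) * (φ w - φ' w) := by
    simp only [mul_sub]
    rw [integral_sub (hk.mul_bdd (hshift hφ).aestronglyMeasurable (ae_of_all _ fun s => hM _))
      (hk.mul_bdd (hshift hφ').aestronglyMeasurable (ae_of_all _ fun s => hM' _)),
      integral_sub (ha.mul_bdd hφ.aestronglyMeasurable (ae_of_all _ hM))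
      (ha.mul_bdd hφ'.aestronglyMeasurable (ae_of_all _ hM')), correlationDefect, correlationDefect]
    ring
  rw [e, add_mul, ← integral_mul_const, ← integral_mul_const]
  refine (norm_sub_le _ _).trans (add_le_add ?_ ?_)
  · refine norm_integral_le_of_norm_le ((integrable_expKernel t).mul_const ε)
      (ae_of_all _ fun s => ?_)
    rw [norm_mul, Complex.norm_of_nonneg (expKernel_pos _ _).le]
    exact mul_le_mul_of_nonneg_left (hε _) (expKernel_pos _ _).le
  · refine norm_integral_le_of_norm_le ((integrable_kernelBound t K hb).mul_const ε)
      (ae_of_all _ fun w => ?_)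
    rw [norm_mul, Complex.norm_of_nonneg (averagedKernel_nonneg _ _ _)]
    exact (mul_le_mul_of_nonneg_left (hε _) (averagedKernel_nonneg _ _ _)).trans
      (mul_le_mul_of_nonneg_right (averagedKernel_le hf hC htail t w) hε0)

/-- The autocorrelation of a function along the special flow. -/
noncomputable def correlation (μ : Measure X) (T : X ≃ᵐ X) (f : X → ℝ) (g : X × ℝ → ℂ) (t : ℝ) :
    ℂ :=
  ∫ p, g (flow T.toEquiv f t p) * conj (g p) ∂(regionMeasure μ f)

variable {a : ℝ}

/-- For functions vanishing above height `R` the fibre measure can be cut to `[0, R]`, giving the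
finite measure `ν` needed in `tendsto_correlationDefect_of_bounded`; the constraint to `X^f` moves
into the second factor. -/
theorem correlation_eq_integral_prod (hf : Measurable f) {g : X × ℝ → ℂ} {R : ℝ}
    (hgR : ∀ p : X × ℝ, R < p.2 → g p = 0) (t : ℝ) :
    correlation μ T f g t = ∫ p, g (flow T.toEquiv f 0 (p.1, p.2 + t)) *
      (region f).indicator (fun p => conj (g p)) p ∂(μ.prod (volume.restrict (Set.Icc 0 R))) := by
  have hreg := measurableSet_region hf
  have e : μ.prod (volume.restrict (Set.Icc 0 R))
      = (μ.prod volume).restrict (Set.univ ×ˢ Set.Icc 0 R) := by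
    rw [← Measure.prod_restrict, Measure.restrict_univ]
  rw [correlation, regionMeasure, e, ← integral_indicator hreg,
    ← integral_indicator (MeasurableSet.univ.prod measurableSet_Icc)]
  refine integral_congr_ae (ae_of_all _ fun p => ?_)
  simp only [flow_eq_flow_zero T.toEquiv f t]
  by_cases hp : p ∈ region f
  · by_cases hpR : p.2 ≤ R
    · have : p ∈ (Set.univ : Set X) ×ˢ Set.Icc 0 R := ⟨trivial, hp.1, hpR⟩
      simp [hp, this]
    · have : p ∉ (Set.univ : Set X) ×ˢ Set.Icc 0 R := fun hh => hpR hh.2.2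
      simp [hp, this, hgR p (not_le.1 hpR)]
  · by_cases hpR : p ∈ (Set.univ : Set X) ×ˢ Set.Icc 0 R <;> simp [hp, hpR]

section

variable (ha : 0 < a) (hfa : ∀ x, a ≤ f x)
include ha hfa

theorem measurable_correlation (hf : Measurable f) {g : X × ℝ → ℂ} (hg : Measurable g) :
    Measurable (correlation μ T f g) := by
  have hflow := measurable_flow (T := T) ha hfa hf 0
  have : SFinite (regionMeasure μ f) := by unfold regionMeasure; infer_instance
  have e : correlation μ T f g = fun t => ∫ p, g (flow T.toEquiv f 0 (p.1, p.2 + t)) * conj (g p)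
      ∂(regionMeasure μ f) := funext fun t => integral_congr_ae (ae_of_all _ fun p => by
    beta_reduce
    rw [flow_eq_flow_zero _ _ t])
  rw [e]
  refine (StronglyMeasurable.integral_prod_right' (ν := regionMeasure μ f)
    (f := fun q : ℝ × (X × ℝ) => g (flow T.toEquiv f 0 (q.2.1, q.2.2 + q.1)) * conj (g q.2))
    ?_).measurable
  refine Measurable.stronglyMeasurable (Measurable.mul ?_ ?_)
  · exact hg.comp (hflow.comp (by fun_prop))
  · exact Complex.continuous_conj.measurable.comp (hg.comp measurable_snd)

/-- Write the difference as `⟨g ∘ T_t, g - g'⟩ + ⟨(g - g') ∘ T_t, g'⟩`. Composition with the flow is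
an isometry, so the bound is uniform in `t`. -/
theorem norm_correlation_sub_le (hT : MeasurePreserving T μ μ) (hf : Measurable f)
    {g g' : X × ℝ → ℂ} (hg : MemLp g 2 (regionMeasure μ f)) (hg' : MemLp g' 2 (regionMeasure μ f))
    (t : ℝ) :
    ‖correlation μ T f g t - correlation μ T f g' t‖
      ≤ ‖(hg.sub hg').toLp (g - g')‖ * (‖hg.toLp g‖ + ‖hg'.toLp g'‖) := by
  have hφ := measurePreserving_flow (μ := μ) ha hfa hT hf t
  have hc : ∀ {k : X × ℝ → ℂ}, MemLp k 2 (regionMeasure μ f) →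
      MemLp (k ∘ flow T.toEquiv f t) 2 (regionMeasure μ f) := fun hk =>
    hk.comp_measurePreserving hφ
  have hn : ∀ {k : X × ℝ → ℂ} (hk : MemLp k 2 (regionMeasure μ f)),
      ‖(hc hk).toLp _‖ = ‖hk.toLp k‖ := fun hk => by
    rw [Lp.norm_toLp, Lp.norm_toLp]
    exact congrArg _ (eLpNorm_comp_measurePreserving hk.1 hφ)
  have e : correlation μ T f g t - correlation μ T f g' t
      = inner ℂ ((hg.sub hg').toLp (g - g')) ((hc hg).toLp _)
        + inner ℂ (hg'.toLp g') ((hc (hg.sub hg')).toLp _) := by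
    have h1 : correlation μ T f g t = inner ℂ (hg.toLp g) ((hc hg).toLp _) :=
      (inner_toLp hg (hc hg)).symm
    have h2 : correlation μ T f g' t = inner ℂ (hg'.toLp g') ((hc hg').toLp _) :=
      (inner_toLp hg' (hc hg')).symm
    have h3 : (hc (hg.sub hg')).toLp _ = (hc hg).toLp _ - (hc hg').toLp _ :=
      MemLp.toLp_sub (hc hg) (hc hg')
    rw [h1, h2, h3, MemLp.toLp_sub hg hg', inner_sub_left, inner_sub_right]
    ring
  rw [e, mul_add]
  refine (norm_add_le _ _).trans (add_le_add ?_ ?_)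
  · exact (norm_inner_le_norm _ _).trans_eq (by rw [hn])
  · exact (norm_inner_le_norm _ _).trans_eq (by rw [hn, mul_comm])

end

/-- Truncation of a function on `X × ℝ` in size and height. -/
noncomputable def truncation (g : X × ℝ → ℂ) (N : ℕ) : X × ℝ → ℂ :=
  {p | ‖g p‖ ≤ N ∧ p.2 ≤ N}.indicator g

omit [IsProbabilityMeasure μ] in
theorem tendsto_norm_toLp_sub_truncation {ν : Measure (X × ℝ)} {g : X × ℝ → ℂ} (hg : MemLp g 2 ν)
    (hgN : ∀ N, MemLp (truncation g N) 2 ν) :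
    Tendsto (fun N => ‖(hg.sub (hgN N)).toLp (g - truncation g N)‖) atTop (𝓝 0) := by
  have hsq : ∀ N, ‖(hg.sub (hgN N)).toLp (g - truncation g N)‖ ^ 2
      = ∫ p, ‖(g - truncation g N) p‖ ^ 2 ∂ν := fun N => by
    have h1 := inner_self_eq_norm_sq_to_K (𝕜 := ℂ) ((hg.sub (hgN N)).toLp (g - truncation g N))
    rw [inner_toLp] at h1
    simp only [Complex.mul_conj'] at h1
    simp only [← Complex.ofReal_pow] at h1
    rw [integral_complex_ofReal] at h1
    exact Complex.ofReal_injective (by push_cast at h1 ⊢; exact h1.symm)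
  have hlim : Tendsto (fun N => ∫ p, ‖(g - truncation g N) p‖ ^ 2 ∂ν) atTop (𝓝 0) := by
    have hzero : ∫ p, (0 : ℝ) ∂ν = 0 := by simp
    rw [← hzero]
    refine tendsto_integral_of_dominated_convergence (fun p => ‖g p‖ ^ 2)
      (fun N => ((hg.sub (hgN N)).1.norm.pow 2)) ((memLp_two_iff_integrable_sq_norm hg.1).1 hg)
      (fun N => ae_of_all _ fun p => ?_) (ae_of_all _ fun p => ?_)
    · rw [Real.norm_of_nonneg (by positivity), truncation, Pi.sub_apply]
      by_cases hp : p ∈ {p | ‖g p‖ ≤ N ∧ p.2 ≤ N} <;> simp [hp]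
    · refine tendsto_const_nhds.congr' ?_
      filter_upwards [eventually_ge_atTop ⌈‖g p‖⌉₊, eventually_ge_atTop ⌈p.2⌉₊] with N h1 h2
      have hp : p ∈ {p : X × ℝ | ‖g p‖ ≤ N ∧ p.2 ≤ N} := ⟨Nat.ceil_le.1 h1, Nat.ceil_le.1 h2⟩
      rw [truncation, Pi.sub_apply, Set.indicator_of_mem hp]
      simp
  simp only [← hsq] at hlim
  have := hlim.sqrt
  simpa using this

theorem tendsto_correlationDefect (hT : Ergodic T μ) (hf : Measurable f)
    (hf_int : Integrable f μ) (ha : 0 < a) (hfa : ∀ x, a ≤ f x) (hh : IsRigiditySequence T μ h)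
    (hC_meas : ∀ n, MeasurableSet (C n)) (hC : Tendsto (fun n => μ (C n)) atTop (𝓝 1))
    {K b : ℝ} (hb : 0 < b) (htail : ∀ n s, 0 ≤ s →
      μ.real {x ∈ C n | s ≤ |birkhoffSum T f (h n) x - c n|} ≤ K * Real.exp (-b * s))
    {g : X × ℝ → ℂ} (hg : MemLp g 2 (regionMeasure μ f)) (t : ℝ) :
    Tendsto (fun n => correlationDefect μ t (correlation μ T f g) (c n) (deviation T f h C c n))
      atTop (𝓝 0) := by
  have hflow := fun s => measurePreserving_flow (μ := μ) ha hfa hT.toMeasurePreserving hf s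
  -- Changing `g` on a null set does not affect its correlations, because the flow preserves null
  -- sets.
  wlog hg_meas : Measurable g generalizing g with hmeas
  · obtain ⟨k, hk, hgk⟩ := hg.1
    have hkL : MemLp k 2 (regionMeasure μ f) := hg.ae_eq hgk
    have : correlation μ T f g = correlation μ T f k := funext fun s => by
      refine integral_congr_ae ?_
      filter_upwards [hgk, (hflow s).quasiMeasurePreserving.ae hgk] with p h1 h2
      rw [h1, h2]
    rw [this]
    exact hmeas hkL hk.measurable
  have hg_norm : Measurable fun p => ‖g p‖ := hg_meas.norm
  have hset : ∀ N : ℕ, MeasurableSet {p : X × ℝ | ‖g p‖ ≤ N ∧ p.2 ≤ N} := fun N =>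
    (measurableSet_le hg_norm measurable_const).inter
      (measurableSet_le measurable_snd measurable_const)
  have hN_meas : ∀ N, Measurable (truncation g N) := fun N => hg_meas.indicator (hset N)
  have hN : ∀ N, MemLp (truncation g N) 2 (regionMeasure μ f) := fun N => hg.indicator (hset N)
  have hN_le : ∀ N p, ‖truncation g N p‖ ≤ N := fun N p => by
    rw [truncation]
    by_cases hp : p ∈ {p : X × ℝ | ‖g p‖ ≤ N ∧ p.2 ≤ N}
    · rw [Set.indicator_of_mem hp]
      exact hp.1
    · rw [Set.indicator_of_notMem hp, norm_zero]
      positivity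
  have hbd : ∀ {k : X × ℝ → ℂ}, MemLp k 2 (regionMeasure μ f) →
      ∃ M, ∀ s, ‖correlation μ T f k s‖ ≤ M := fun {k} hk => ⟨_, fun s => by
    have := norm_correlation_sub_le ha hfa hT.toMeasurePreserving hf hk
      (MemLp.zero' : MemLp (fun _ => (0 : ℂ)) 2 (regionMeasure μ f)) s
    rwa [show correlation μ T f (fun _ => (0 : ℂ)) s = 0 by simp [correlation], sub_zero] at this⟩
  obtain ⟨M, hM⟩ := hbd hg
  have hdefect : ∀ N, Tendsto (fun n => correlationDefect μ t (correlation μ T f (truncation g N))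
      (c n) (deviation T f h C c n)) atTop (𝓝 0) := fun N => by
    have hvanish : ∀ p : X × ℝ, (N : ℝ) < p.2 → truncation g N p = 0 := fun p hp =>
      Set.indicator_of_notMem (fun hh => hp.not_ge hh.2) _
    rw [show correlation μ T f (truncation g N) = _ from
      funext fun s => correlation_eq_integral_prod hf hvanish s]
    refine tendsto_correlationDefect_of_bounded hT hf hf_int hh hC_meas hC hb htail
      (volume.restrict (Set.Icc 0 (N : ℝ))) (G := fun p => truncation g N (flow T.toEquiv f 0 p))
      ((hN_meas N).comp (measurable_flow ha hfa hf 0))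
      ((Complex.continuous_conj.measurable.comp (hN_meas N)).indicator (measurableSet_region hf))
      (M := N) (N := N) (fun p => hN_le N _) (fun p => ?_) (fun n x r => ?_) t
    · refine (norm_indicator_le_norm_self _ _).trans ?_
      rw [Function.comp_apply, RCLike.norm_conj]
      exact hN_le N p
    · have := flow_zero_iterate (T := T.toEquiv) ha hfa n x r
      exact congrArg (truncation g N) this
  set A := (∫ s, expKernel t s) + ∫ w, kernelBound t K b w
  have hB := tendsto_norm_toLp_sub_truncation hg hN
  set B : ℕ → ℝ := fun N => ‖(hg.sub (hN N)).toLp (g - truncation g N)‖ with hB_def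
  have hBlim : Tendsto (fun N => A * (B N * (‖hg.toLp g‖ + (‖hg.toLp g‖ + B N)))) atTop (𝓝 0) := by
    have := (hB.mul ((hB.const_add ‖hg.toLp g‖).const_add ‖hg.toLp g‖)).const_mul A
    simpa using this
  -- Nonnegativity is read off from the defect estimate with `φ = φ' = 0` and `ε = 1`.
  have hA0 : 0 ≤ A := by
    have := norm_correlationDefect_sub_le hf hC_meas hb (htail 0) t (φ := 0) (φ' := 0) (M := 0)
      (M' := 0) (ε := 1) measurable_zero measurable_zero (by simp) (by simp) (by simp)
    simpa using (norm_nonneg _).trans this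
  rw [Metric.tendsto_nhds]
  intro ε hε
  obtain ⟨N, hNε⟩ := ((tendsto_order.1 hBlim).2 (ε / 2) (by positivity)).exists
  obtain ⟨M', hM'⟩ := hbd (hN N)
  filter_upwards [Metric.tendsto_nhds.1 (hdefect N) (ε / 2) (by positivity)] with n hn
  rw [dist_zero_right] at hn ⊢
  have h1 := norm_correlationDefect_sub_le hf hC_meas hb (htail n) t
    (measurable_correlation ha hfa hf hg_meas) (measurable_correlation ha hfa hf (hN_meas N)) hM hM'
    (fun s => norm_correlation_sub_le ha hfa hT.toMeasurePreserving hf hg (hN N) s)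
  have h2 : ‖(hN N).toLp (truncation g N)‖ ≤ ‖hg.toLp g‖ + B N := by
    rw [hB_def]
    beta_reduce
    rw [MemLp.toLp_sub hg (hN N)]
    exact norm_le_norm_add_norm_sub _ _
  have h3 : A * (B N * (‖hg.toLp g‖ + ‖(hN N).toLp (truncation g N)‖))
      ≤ A * (B N * (‖hg.toLp g‖ + (‖hg.toLp g‖ + B N))) := by
    have : 0 ≤ B N := norm_nonneg _
    gcongr
  set z := correlationDefect μ t (correlation μ T f g) (c n) (deviation T f h C c n)
  set w := correlationDefect μ t (correlation μ T f (truncation g N)) (c n) (deviation T f h C c n)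
  calc ‖z‖ ≤ ‖z - w‖ + ‖w‖ := by simpa using norm_add_le (z - w) w
    _ < ε := by linarith

end

end SpecialFlow

/-! ### Limits of distributions with exponential tails -/

section Tails

variable {P : Measure ℝ} [IsProbabilityMeasure P] {K b : ℝ}

theorem integrable_exp_mul_abs_of_tail (hb : 0 < b)
    (htail : ∀ s : ℝ, 0 ≤ s → P {u | s < |u|} ≤ ENNReal.ofReal (K * Real.exp (-b * s))) :
    Integrable (fun u => Real.exp (b / 2 * |u|)) P := by
  refine ⟨Measurable.aestronglyMeasurable (by fun_prop), ?_⟩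
  have hmeas : ∀ k : ℕ, MeasurableSet {u : ℝ | (k : ℝ) < |u|} := fun k =>
    measurableSet_lt measurable_const measurable_id.abs
  -- Discretise `|u|` upwards to integers. The exponent is half the decay rate, so the expectations
  -- are dominated by a geometric series of ratio `e^{-b/2}`.
  have hpt : ∀ u : ℝ, ‖Real.exp (b / 2 * |u|)‖ₑ ≤ 1 + ∑' k : ℕ, {u : ℝ | (k : ℝ) < |u|}.indicator
      (fun _ => ENNReal.ofReal (Real.exp (b / 2 * (k + 1)))) u := by
    intro u
    rw [Real.enorm_of_nonneg (Real.exp_pos _).le]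
    rcases eq_or_lt_of_le (abs_nonneg u) with hu | hu
    · simp [← hu]
    · obtain ⟨k, hk⟩ := Nat.exists_eq_succ_of_ne_zero (Nat.ceil_pos.2 hu).ne'
      have h1 : (k : ℝ) < |u| := Nat.lt_ceil.1 (by omega)
      have h2 : |u| ≤ k + 1 := by
        have := Nat.le_ceil |u|
        rw [hk] at this
        exact_mod_cast this
      refine le_trans ?_ (le_add_of_nonneg_left zero_le)
      refine le_trans ?_ (ENNReal.le_tsum k)
      rw [Set.indicator_of_mem (by exact h1)]
      gcongr
  refine (lintegral_mono hpt).trans_lt ?_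
  rw [lintegral_add_left measurable_const, lintegral_tsum fun k =>
    (measurable_const.indicator (hmeas k)).aemeasurable]
  refine ENNReal.add_lt_top.2 ⟨by simp, ?_⟩
  have hle : ∀ k : ℕ, ∫⁻ u, {u : ℝ | (k : ℝ) < |u|}.indicator
      (fun _ => ENNReal.ofReal (Real.exp (b / 2 * (k + 1)))) u ∂P
      ≤ ENNReal.ofReal (K * Real.exp (b / 2) * Real.exp (-(b / 2)) ^ k) := by
    intro k
    rw [lintegral_indicator_const (hmeas k)]
    refine (mul_le_mul_right (htail k k.cast_nonneg) _).trans_eq ?_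
    rw [← ENNReal.ofReal_mul (Real.exp_pos _).le, mul_left_comm, mul_assoc, ← Real.exp_nat_mul,
      ← Real.exp_add, ← Real.exp_add]
    ring_nf
  refine (ENNReal.tsum_le_tsum hle).trans_lt (lt_top_iff_ne_top.2 ?_)
  refine Summable.tsum_ofReal_ne_top ((summable_geometric_of_lt_one (Real.exp_pos _).le ?_).mul_left _)
  simpa using hb

/-- Exponential moments extend the characteristic function analytically to the strip `|Re z| < b /
2`. It equals `1` at the origin, so its zeros are isolated by the identity theorem, and a discrete
subset of the line is countable. -/
theorem charFun_zeros_countable_of_tail (hb : 0 < b)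
    (htail : ∀ s : ℝ, 0 ≤ s → P {u | s < |u|} ≤ ENNReal.ofReal (K * Real.exp (-b * s))) :
    {v : ℝ | charFun P v = 0}.Countable := by
  have hint := integrable_exp_mul_abs_of_tail hb htail
  set U : Set ℂ := {z | z.re ∈ Set.Ioo (-(b / 2)) (b / 2)} with hU
  have hsub : Set.Ioo (-(b / 2)) (b / 2) ⊆ interior (ProbabilityTheory.integrableExpSet id P) := by
    refine interior_maximal (fun s hs => ?_) isOpen_Ioo
    refine hint.mono' (Measurable.aestronglyMeasurable (by fun_prop)) (ae_of_all _ fun u => ?_)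
    rw [Real.norm_of_nonneg (Real.exp_pos _).le, Real.exp_le_exp, id]
    calc s * u ≤ |s * u| := le_abs_self _
      _ = |s| * |u| := abs_mul s u
      _ ≤ b / 2 * |u| := by
        have := (abs_lt.2 hs).le
        gcongr
  have hF : AnalyticOnNhd ℂ (ProbabilityTheory.complexMGF id P) U := fun z hz =>
    ProbabilityTheory.analyticAt_complexMGF (hsub hz)
  have hUconn : IsPreconnected U :=
    ((convex_Ioo (-(b / 2)) (b / 2)).linear_preimage Complex.reLm).isPreconnected
  have hmem : ∀ v : ℝ, (v * Complex.I : ℂ) ∈ U := fun v => by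
    simp only [hU, Set.mem_ofPred_eq, Set.mem_Ioo, Complex.mul_I_re, Complex.ofReal_im]
    constructor <;> linarith
  have hchar : ∀ v : ℝ, charFun P v = ProbabilityTheory.complexMGF id P (v * Complex.I) :=
    fun v => (ProbabilityTheory.complexMGF_id_mul_I v).symm
  refine (HereditarilyLindelofSpace.isLindelof _).countable_of_isDiscrete ?_
  rw [isDiscrete_iff_nhdsNE]
  intro v _
  rcases (hF _ (hmem v)).eventually_eq_zero_or_eventually_ne_zero with h0 | h0
  · have h1 := hF.eqOn_zero_of_preconnected_of_eventuallyEq_zero hUconn (hmem v) h0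
      (by simpa using hmem 0 : (0 : ℂ) ∈ U)
    have h2 := hchar 0
    rw [charFun_zero, Complex.ofReal_zero, zero_mul, h1] at h2
    simp at h2
  · have ht : Tendsto (fun w : ℝ => (w * Complex.I : ℂ)) (𝓝[≠] v) (𝓝[≠] (v * Complex.I)) := by
      refine tendsto_nhdsWithin_of_tendsto_nhds_of_eventually_within _
        ((by fun_prop : Continuous fun w : ℝ => (w * Complex.I : ℂ)).tendsto v |>.mono_left
          nhdsWithin_le_nhds) ?_
      filter_upwards [self_mem_nhdsWithin] with w hw
      simpa using hw
    rw [← disjoint_iff, disjoint_principal_right]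
    filter_upwards [ht.eventually h0] with w hw
    rw [Set.mem_compl_iff, Set.mem_ofPred_eq, hchar]
    exact hw

/-- Distributions with uniform exponential tails have a subsequence whose characteristic functions
converge pointwise to a function with countably many zeros. -/
theorem exists_subseq_tendsto_charFun_of_tail (hb : 0 < b) (P : ℕ → ProbabilityMeasure ℝ)
    (htail : ∀ n, ∀ s : ℝ, 0 ≤ s →
      (P n : Measure ℝ) {u | s < |u|} ≤ ENNReal.ofReal (K * Real.exp (-b * s))) :
    ∃ (θ : ℕ → ℕ) (q : ℝ → ℂ), StrictMono θ ∧ {v | q v = 0}.Countable ∧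
      ∀ v, Tendsto (fun n => charFun (P (θ n) : Measure ℝ) v) atTop (𝓝 (q v)) := by
  have htight : IsTightMeasureSet {((Q : ProbabilityMeasure ℝ) : Measure ℝ) | Q ∈ Set.range P} := by
    refine isTightMeasureSet_of_tendsto_measure_norm_gt ?_
    have hlim : Tendsto (fun s : ℝ => ENNReal.ofReal (K * Real.exp (-b * s))) atTop (𝓝 0) := by
      rw [← ENNReal.ofReal_zero]
      refine (ENNReal.continuous_ofReal.tendsto 0).comp ?_
      have := (Real.tendsto_exp_atBot.comp
        (tendsto_id.const_mul_atTop_of_neg (neg_lt_zero.2 hb))).const_mul K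
      simpa using this
    refine tendsto_of_tendsto_of_tendsto_of_le_of_le' tendsto_const_nhds hlim
      (Eventually.of_forall fun _ => zero_le) ?_
    filter_upwards [eventually_ge_atTop 0] with s hs
    refine iSup₂_le fun Q hQ => ?_
    obtain ⟨_, ⟨n, rfl⟩, rfl⟩ := hQ
    exact htail n s hs
  obtain ⟨Q, -, θ, hθ, hlim⟩ := (isCompact_closure_of_isTightMeasureSet htight).tendsto_subseq
    (x := P) fun n => subset_closure ⟨n, rfl⟩
  refine ⟨θ, charFun (Q : Measure ℝ), hθ, charFun_zeros_countable_of_tail (K := K) hb fun s hs => ?_,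
    fun v => ProbabilityMeasure.tendsto_iff_tendsto_charFun.1 hlim v⟩
  -- Tails with strict inequality are open sets, so the portmanteau inequality carries the bound to
  -- the limit law.
  have hopen : IsOpen {u : ℝ | s < |u|} := isOpen_lt continuous_const continuous_abs
  refine (ProbabilityMeasure.le_liminf_measure_open_of_tendsto hlim hopen).trans ?_
  refine liminf_le_of_frequently_le' (Frequently.of_forall fun n => ?_)
  exact htail _ s hs

end Tails

/-! ### Spectral form of the defect -/

namespace SpecialFlow

theorem integral_expKernel_mul_exp (t v : ℝ) :
    ∫ s, (expKernel t s : ℂ) * Complex.exp (Complex.I * s * v)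
      = Complex.exp (Complex.I * t * v) * ((2 / (1 + v ^ 2) : ℝ) : ℂ) := by
  have hint : Integrable fun s => (expKernel 0 s : ℂ) * Complex.exp (Complex.I * s * v) :=
    (integrable_expKernel 0).ofReal.mul_bdd (c := 1)
      (by fun_prop) (ae_of_all _ fun s => (norm_exp_I_mul_mul s v).le)
  have h1 : ∫ s in Set.Iic (0 : ℝ), (expKernel 0 s : ℂ) * Complex.exp (Complex.I * s * v)
      = 1 / (1 + Complex.I * v) := by
    have := integral_exp_mul_complex_Iic (a := 1 + Complex.I * v) (by simp) 0
    rw [Complex.ofReal_zero, mul_zero, Complex.exp_zero] at this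
    rw [← this]
    refine setIntegral_congr_fun measurableSet_Iic fun s hs => ?_
    simp only [expKernel, sub_zero, abs_of_nonpos (Set.mem_Iic.1 hs), neg_neg]
    rw [Complex.ofReal_exp, ← Complex.exp_add]
    ring_nf
  have h2 : ∫ s in Set.Ioi (0 : ℝ), (expKernel 0 s : ℂ) * Complex.exp (Complex.I * s * v)
      = - 1 / (-1 + Complex.I * v) := by
    have := integral_exp_mul_complex_Ioi (a := -1 + Complex.I * v) (by simp) 0
    rw [Complex.ofReal_zero, mul_zero, Complex.exp_zero] at this
    rw [← this]
    refine setIntegral_congr_fun measurableSet_Ioi fun s hs => ?_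
    simp only [expKernel, sub_zero, abs_of_pos (Set.mem_Ioi.1 hs)]
    rw [Complex.ofReal_exp, ← Complex.exp_add]
    push_cast
    ring_nf
  have h3 : ∫ s, (expKernel 0 s : ℂ) * Complex.exp (Complex.I * s * v)
      = ((2 / (1 + v ^ 2) : ℝ) : ℂ) := by
    rw [← intervalIntegral.integral_Iic_add_Ioi hint.integrableOn hint.integrableOn, h1, h2]
    have e1 : (1 + Complex.I * v : ℂ) ≠ 0 := fun h => by simpa using congrArg Complex.re h
    have e2 : (-1 + Complex.I * v : ℂ) ≠ 0 := fun h => by simpa using congrArg Complex.re h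
    have e3 : (1 + (v : ℂ) ^ 2) ≠ 0 := by
      have : (0 : ℝ) < 1 + v ^ 2 := by positivity
      exact_mod_cast this.ne'
    push_cast
    field_simp
    ring_nf
    simp only [Complex.I_sq]
    ring
  -- The case of general `t` follows from `t = 0` by translation.
  rw [← h3, ← integral_const_mul, ← integral_add_right_eq_self _ t]
  refine integral_congr_ae (ae_of_all _ fun s => ?_)
  simp only [expKernel, add_sub_cancel_right, sub_zero]
  rw [mul_left_comm, ← Complex.exp_add]
  push_cast
  ring_nf

/-- By Fubini, smoothing becomes multiplication by the kernel's Fourier transform, and averaging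
over `w = s - ξ` becomes multiplication by the characteristic function of `ξ` at `-v`. -/
theorem correlationDefect_eq_integral {X : Type*} [MeasurableSpace X] {μ : Measure X}
    [IsProbabilityMeasure μ] {ξ : X → ℝ} (hξ : Measurable ξ) {σ : Measure ℝ} [IsFiniteMeasure σ]
    {φ : ℝ → ℂ} (hφ : ∀ s : ℝ, φ s = ∫ v : ℝ, Complex.exp (Complex.I * s * v) ∂σ) (t c : ℝ) :
    correlationDefect μ t φ c ξ = ∫ v : ℝ, Complex.exp (Complex.I * t * v) *
      (((2 / (1 + v ^ 2) : ℝ) : ℂ) * (Complex.exp (Complex.I * c * v) - charFun (μ.map ξ) (-v)))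
        ∂σ := by
  have hi₁ : Integrable (fun q : ℝ × ℝ => (expKernel t (q.2 + 0) : ℂ) *
      Complex.exp (Complex.I * ((c + q.2 : ℝ) : ℂ) * q.1)) (σ.prod volume) :=
    integrable_expKernel_mul σ t (ξ := fun _ => 0) measurable_const
      (F := fun q => Complex.exp (Complex.I * ((c + q.2 : ℝ) : ℂ) * q.1)) (by fun_prop)
      (M := 1) fun q => (norm_exp_I_mul_mul _ _).le
  have hΦ : Integrable fun w => (averagedKernel μ t ξ w : ℂ) := by
    have := (integrable_expKernel_mul μ t hξ (F := fun _ => 1) measurable_const (M := 1)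
      (fun _ => by simp)).integral_prod_right
    simpa [averagedKernel_ofReal] using this
  have hi₂ : Integrable (fun q : ℝ × ℝ => (averagedKernel μ t ξ q.2 : ℂ) *
      Complex.exp (Complex.I * q.2 * q.1)) (σ.prod volume) :=
    (hΦ.comp_snd σ).mul_bdd (c := 1) (Measurable.aestronglyMeasurable (by fun_prop))
      (ae_of_all _ fun q => (norm_exp_I_mul_mul _ _).le)
  have h1 : ∫ s, (expKernel t s : ℂ) * φ (c + s) = ∫ v : ℝ, Complex.exp (Complex.I * t * v) *
      (((2 / (1 + v ^ 2) : ℝ) : ℂ) * Complex.exp (Complex.I * c * v)) ∂σ := by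
    simp only [hφ, ← integral_const_mul]
    simp only [add_zero] at hi₁
    rw [← integral_integral_swap hi₁]
    refine integral_congr_ae (ae_of_all _ fun v => ?_)
    beta_reduce
    rw [← mul_assoc, ← integral_expKernel_mul_exp, ← integral_mul_const]
    refine integral_congr_ae (ae_of_all _ fun s => ?_)
    beta_reduce
    rw [mul_assoc (expKernel t s : ℂ), ← Complex.exp_add]
    push_cast
    ring_nf
  have hinner : ∀ v : ℝ, ∫ w, (averagedKernel μ t ξ w : ℂ) * Complex.exp (Complex.I * w * v)
      = Complex.exp (Complex.I * t * v) *
        (((2 / (1 + v ^ 2) : ℝ) : ℂ) * charFun (μ.map ξ) (-v)) := fun v => by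
    have hi₃ := integrable_expKernel_mul μ t hξ
      (F := fun q : X × ℝ => Complex.exp (Complex.I * q.2 * v)) (by fun_prop) (M := 1)
      fun q => (norm_exp_I_mul_mul _ _).le
    simp only [averagedKernel_ofReal, ← integral_mul_const]
    rw [← integral_integral_swap hi₃, charFun_apply_real, integral_map hξ.aemeasurable
      (Measurable.aestronglyMeasurable (by fun_prop)), ← mul_assoc, ← integral_const_mul]
    refine integral_congr_ae (ae_of_all _ fun x => ?_)
    beta_reduce
    rw [← integral_expKernel_mul_exp, ← integral_mul_const, ← integral_add_right_eq_self (fun s : ℝ =>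
      (expKernel t s : ℂ) * Complex.exp (Complex.I * s * v) * _) (ξ x)]
    refine integral_congr_ae (ae_of_all _ fun w => ?_)
    beta_reduce
    rw [mul_assoc (expKernel t (w + ξ x) : ℂ), ← Complex.exp_add]
    push_cast
    ring_nf
  have h2 : ∫ w, (averagedKernel μ t ξ w : ℂ) * φ w = ∫ v : ℝ, Complex.exp (Complex.I * t * v) *
      (((2 / (1 + v ^ 2) : ℝ) : ℂ) * charFun (μ.map ξ) (-v)) ∂σ := by
    simp only [hφ, ← integral_const_mul]
    rw [← integral_integral_swap hi₂]
    exact integral_congr_ae (ae_of_all _ hinner)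
  have hκ : ∀ v : ℝ, ‖((2 / (1 + v ^ 2) : ℝ) : ℂ)‖ ≤ 2 := fun v => by
    rw [Complex.norm_of_nonneg (by positivity)]
    exact div_le_self zero_le_two (by nlinarith [sq_nonneg v])
  have hbd : ∀ {p : ℝ → ℂ}, Measurable p → (∀ v, ‖p v‖ ≤ 1) → Integrable (fun v : ℝ =>
      Complex.exp (Complex.I * t * v) * (((2 / (1 + v ^ 2) : ℝ) : ℂ) * p v)) σ := fun hp hp1 => by
    refine Integrable.of_bound (Measurable.aestronglyMeasurable (by fun_prop)) (2 * 1)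
      (ae_of_all _ fun v => ?_)
    rw [norm_mul, norm_exp_I_mul_mul, one_mul, norm_mul]
    exact mul_le_mul (hκ v) (hp1 v) (norm_nonneg _) zero_le_two
  have := Measure.isProbabilityMeasure_map (μ := μ) hξ.aemeasurable
  rw [correlationDefect, h1, h2, ← integral_sub]
  · refine integral_congr_ae (ae_of_all _ fun v => ?_)
    beta_reduce
    ring
  · exact hbd (by fun_prop) fun v => (norm_exp_I_mul_mul _ _).le
  · exact hbd (measurable_charFun.comp measurable_neg) fun v => norm_charFun_le_one _

end SpecialFlow

/-! ### Singularity of the spectral measures -/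

namespace SpecialFlow

section

variable {X : Type*} [MeasurableSpace X] {μ : Measure X} [IsProbabilityMeasure μ] {T : X ≃ᵐ X}
  {f : X → ℝ} {h : ℕ → ℕ} {C : ℕ → Set X} {c : ℕ → ℝ} {a K b : ℝ}

/-- Everywhere `S_{h n}(f) ≥ a * h n ≥ a * n`, while for large `n` some point of `C n` has deviation
below a fixed `s`; hence `c n ≥ a * n - s`. -/
theorem tendsto_centering_atTop (ha : 0 < a) (hfa : ∀ x, a ≤ f x) (hh : StrictMono h)
    (hC : Tendsto (fun n => μ (C n)) atTop (𝓝 1)) (hb : 0 < b)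
    (htail : ∀ n s, 0 ≤ s →
      μ.real {x ∈ C n | s ≤ |birkhoffSum T f (h n) x - c n|} ≤ K * Real.exp (-b * s)) :
    Tendsto c atTop atTop := by
  have hexp : Tendsto (fun s : ℝ => K * Real.exp (-b * s)) atTop (𝓝 0) := by
    have := (Real.tendsto_exp_atBot.comp
      (tendsto_id.const_mul_atTop_of_neg (neg_lt_zero.2 hb))).const_mul K
    simpa using this
  -- The tail at `s` has mass below `1 / 2`, so it cannot contain `C n` once `μ (C n) > 1 / 2`.
  obtain ⟨s, hs, hs0⟩ := (((tendsto_order.1 hexp).2 (1 / 2) (by norm_num)).and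
    (eventually_ge_atTop 0)).exists
  have hCr : Tendsto (fun n => μ.real (C n)) atTop (𝓝 1) :=
    (ENNReal.tendsto_toReal ENNReal.one_ne_top).comp hC
  have hlim : Tendsto (fun n : ℕ => a * n - s) atTop atTop :=
    tendsto_atTop_add_const_right _ _ (tendsto_natCast_atTop_atTop.const_mul_atTop ha)
  refine tendsto_atTop_mono' _ ?_ hlim
  filter_upwards [(tendsto_order.1 hCr).1 (1 / 2) (by norm_num)] with n hn
  have hne : ¬ C n ⊆ {x ∈ C n | s ≤ |birkhoffSum T f (h n) x - c n|} := fun hsub => by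
    have h1 := measureReal_mono (μ := μ) hsub
    linarith [htail n s hs0]
  obtain ⟨x, hxC, hx⟩ := Set.not_subset.1 hne
  have hx' : |birkhoffSum T f (h n) x - c n| < s := not_le.1 fun hle => hx ⟨hxC, hle⟩
  have hS : (h n : ℝ) * a ≤ birkhoffSum T f (h n) x := by
    have := Finset.card_nsmul_le_sum (Finset.range (h n)) (fun i => f (T^[i] x)) a
      fun i _ => hfa _
    simpa [birkhoffSum] using this
  have hn' : (n : ℝ) ≤ h n := by exact_mod_cast hh.id_le n
  have := (abs_lt.1 hx').2
  nlinarith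

theorem measure_deviation_lt_le {n : ℕ} (htail : ∀ s, 0 ≤ s →
      μ.real {x ∈ C n | s ≤ |birkhoffSum T f (h n) x - c n|} ≤ K * Real.exp (-b * s)) {s : ℝ}
    (hs : 0 ≤ s) :
    μ {x | s < |deviation T f h C c n x|} ≤ ENNReal.ofReal (K * Real.exp (-b * s)) := by
  have hsub : {x | s < |deviation T f h C c n x|}
      ⊆ {x ∈ C n | s ≤ |birkhoffSum T f (h n) x - c n|} := fun x hx => by
    by_cases hxC : x ∈ C n
    · rw [Set.mem_ofPred_eq, deviation, Set.indicator_of_mem hxC] at hx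
      exact ⟨hxC, hx.le⟩
    · rw [Set.mem_ofPred_eq, deviation, Set.indicator_of_notMem hxC, abs_zero] at hx
      exact absurd hs hx.not_ge
  refine (measure_mono hsub).trans ?_
  rw [← ENNReal.ofReal_toReal (measure_ne_top μ {x ∈ C n | _})]
  exact ENNReal.ofReal_le_ofReal (htail s hs)

/-- The spectral measures of the special flow are singular to all measures on which the characters
`e^{i c v}` tend weakly to zero as `c → ∞`. -/
theorem mutuallySingular_of_isSpectralMeasure (hT : Ergodic T μ) (hf : Measurable f)
    (hf_int : Integrable f μ) (ha : 0 < a) (hfa : ∀ x, a ≤ f x) (hh : IsRigiditySequence T μ h)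
    (hC_meas : ∀ n, MeasurableSet (C n)) (hC : Tendsto (fun n => μ (C n)) atTop (𝓝 1))
    (hb : 0 < b) (htail : ∀ n s, 0 ≤ s →
      μ.real {x ∈ C n | s ≤ |birkhoffSum T f (h n) x - c n|} ≤ K * Real.exp (-b * s))
    {g : X × ℝ → ℂ} (hg : MemLp g 2 (regionMeasure μ f)) {σ τ : Measure ℝ}
    (hσ : IsSpectralMeasure (flow T.toEquiv f) (regionMeasure μ f) g σ) [SigmaFinite τ]
    [NullSingletonClass τ]
    (hτ : ∀ d : ℕ → ℝ, Tendsto d atTop atTop → ∀ y : ℝ → ℂ, Integrable y τ → MemLp y 2 τ →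
      Tendsto (fun n => ∫ v : ℝ, Complex.exp (Complex.I * d n * v) * y v ∂τ) atTop (𝓝 0)) :
    σ ⟂ₘ τ := by
  obtain ⟨_, hσ⟩ := hσ
  have hξ : ∀ n, Measurable (deviation T f h C c n) := fun n => measurable_deviation hf hC_meas n
  have hprob : ∀ n, IsProbabilityMeasure (μ.map (deviation T f h C c n)) := fun n =>
    Measure.isProbabilityMeasure_map (hξ n).aemeasurable
  obtain ⟨θ, q, hθ, hq, hlim⟩ := exists_subseq_tendsto_charFun_of_tail (K := K) hb
    (fun n => ⟨μ.map (deviation T f h C c n), hprob n⟩) fun n s hs => by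
      have hs_meas : MeasurableSet {u : ℝ | s < |u|} :=
        measurableSet_lt measurable_const continuous_abs.measurable
      rw [ProbabilityMeasure.coe_mk, Measure.map_apply (hξ n) hs_meas]
      exact measure_deviation_lt_le (htail n) hs
  refine mutuallySingular_of_exp_asymptotics (c := c ∘ θ) (κ := fun v => 2 / (1 + v ^ 2)) (M := 2)
    (p := fun n v => charFun (μ.map (deviation T f h C c (θ n))) (-v)) (q := fun v => q (-v))
    (by fun_prop) (fun v => by positivity)
    (fun v => div_le_self zero_le_two (by nlinarith [sq_nonneg v]))
    (fun n => measurable_charFun.comp measurable_neg) (fun n v => norm_charFun_le_one _)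
    (fun v => hlim (-v)) (hq.preimage neg_injective) (fun t => ?_)
    (hτ _ ((tendsto_centering_atTop ha hfa hh.1 hC hb htail).comp hθ.tendsto_atTop))
  have h1 := (tendsto_correlationDefect hT hf hf_int ha hfa hh hC_meas hC hb htail hg t).comp
    hθ.tendsto_atTop
  refine h1.congr fun n => ?_
  exact correlationDefect_eq_integral (hξ _) hσ t _

end

end SpecialFlow

theorem mainTheorem5 {X : Type*} [MeasurableSpace X] [StandardBorelSpace X]
    (μ : Measure X) [IsProbabilityMeasure μ]
    (T : X ≃ᵐ X) (hT : Ergodic T μ)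
    (f : X → ℝ) (hf_meas : Measurable f) (hf_int : Integrable f μ)
    (hf_pos : ∃ a : ℝ, 0 < a ∧ ∀ x, a ≤ f x)
    (h : ℕ → ℕ) (hh : IsRigiditySequence T μ h)
    (C : ℕ → Set X) (hC_meas : ∀ n, MeasurableSet (C n))
    (hC : Tendsto (fun n => μ (C n)) atTop (𝓝 1))
    (c : ℕ → ℝ)
    (htail : ∃ K b : ℝ, 0 < K ∧ 0 < b ∧ ∀ t : ℝ, 0 ≤ t → ∀ n : ℕ,
      μ.real {x ∈ C n | t ≤ |SpecialFlow.intBirkhoffSum T.toEquiv f (h n) x - c n|}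
        ≤ K * Real.exp (-b * t)) :
    HasSingularSpectrum (SpecialFlow.flow T.toEquiv f) (SpecialFlow.regionMeasure μ f) ∧
    ∀ {Z : Type*} [MeasurableSpace Z] [StandardBorelSpace Z]
      (ρ : Measure Z) [IsProbabilityMeasure ρ] (R : ℝ → Z → Z), IsMixingFlow R ρ →
      SpectrallyDisjoint (SpecialFlow.flow T.toEquiv f) (SpecialFlow.regionMeasure μ f) R ρ := by
  obtain ⟨a, ha, hfa⟩ := hf_pos
  obtain ⟨K, b, -, hb, htail⟩ := htail
  have htail' : ∀ n s, 0 ≤ s →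
      μ.real {x ∈ C n | s ≤ |birkhoffSum T f (h n) x - c n|} ≤ K * Real.exp (-b * s) :=
    fun n s hs => by
      have := htail s hs n
      simp only [SpecialFlow.intBirkhoffSum_natCast] at this
      exact this
  refine ⟨fun g hg σ hσ => ?_, fun {Z} _ _ ρ _ R hR g hg _ k hk hk0 σ τ hσ hτ => ?_⟩
  · exact SpecialFlow.mutuallySingular_of_isSpectralMeasure hT hf_meas hf_int ha hfa hh hC_meas hC
      hb htail' hg hσ fun d hd y _ _ => tendsto_integral_exp_mul_volume hd y
  · obtain ⟨_, hτ⟩ := hτ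
    have hlim : ∀ d : ℕ → ℝ, Tendsto d atTop atTop → ∀ y : ℝ → ℂ, MemLp y 2 τ →
        Tendsto (fun n => ∫ v : ℝ, Complex.exp (Complex.I * d n * v) * y v ∂τ) atTop (𝓝 0) :=
      -- The Fourier transform of `τ` at `d n + t` is the correlation of `k` at that time, which
      -- tends to zero by mixing.
      fun d hd y hy => tendsto_integral_exp_mul_of_fourier (fun t => by
        simp only [← hτ]
        exact (hR.tendsto_correlation hk hk0).comp (tendsto_atTop_add_const_right _ t hd)) hy
    have := nullSingletonClass_of_exp_tendsto_zero (hlim _ tendsto_natCast_atTop_atTop)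
    exact SpecialFlow.mutuallySingular_of_isSpectralMeasure hT hf_meas hf_int ha hfa hh hC_meas hC
      hb htail' hg hσ fun d hd y _ hy => hlim d hd y hy
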